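/- Let $K_1$ and $K_2$ be finite, connected (in particular non-empty) abstract simplicial complexes, neither of which is isomorphic to the boundary $\partial\Delta^n$ of an $n$-simplex for any $n$, nor to the cycle $C_n$ (the $1$-dimensional complex of a cycle with $n$ vertices) for any $n\ge 3$. A subcomplex $U\le K$ of a simplicial complex $K$ is called *fully connected* in $K$ if $K\cong U * (K-U)$, where $K-U$ is the subcomplex of those simplices of $K$ that contain no vertex of $U$, and $*$ is the join (with $U*\emptyset=U$, so that $U=K$ is allowed). Suppose that there are no non-empty subcomplexes $U_1\le K_1$ and $U_2\le K_2$ with $U_1\cong U_2$ such that $U_1$ is fully connected in $K_1$ and $U_2$ is fully connected in $K_2$. For a simplicial complex $K$, a *discrete vector field* on $K$ is a set $V$ of pairs $(\sigma,\tau)$ of simplices of $K$ with $\sigma\subset\tau$ and $\dim\tau=\dim\sigma+1$, such that each simplex of $K$ is in at most one pair. It is a *gradient vector field* if there is no sequence $\alpha_0,\beta_0,\alpha_1,\beta_1,\dots,\beta_{k-1},\alpha_k=\alpha_0$ with $k\ge 1$, $(\alpha_i,\beta_i)\in V$, $\alpha_{i+1}\subset\beta_i$, $\dim\alpha_{i+1}=\dim\alpha_i$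 and $\alpha_{i+1}\ne\alpha_i$ for $0\le i<k$. The *Morse complex* $\mathcal M(K)$ is the simplicial complex whose $n$-simplices are the gradient vector fields on $K$ with $n+1$ pairs, its vertices being the single pairs. Then, for the disjoint union $K_1\sqcup K_2$, there is an isomorphism of groups $$\operatorname{Aut}\bigl(\mathcal M(K_1\sqcup K_2)\bigr)\;\cong\;\operatorname{Aut}(K_1)\times\operatorname{Aut}(K_2),$$ where $\operatorname{Aut}$ denotes the group of simplicial automorphisms. -/

import Mathlib

namespace PreAbstractSimplicialComplex

/-- The vertex set of a complex (points of the ambient type that are not vertices play no role). -/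
def vertices {α : Type*} (K : PreAbstractSimplicialComplex α) : Set α :=
  {v | {v} ∈ K}

/-- A bijection of vertex sets is an isomorphism of simplicial complexes if a finite set of vertices
is a simplex exactly when its image is a simplex. -/
def IsIsomorphism {α β : Type*} {K : PreAbstractSimplicialComplex α}
    {L : PreAbstractSimplicialComplex β} (e : K.vertices ≃ L.vertices) : Prop :=
  ∀ s : Finset K.vertices,
    (s.map e.toEmbedding).map (Function.Embedding.subtype _) ∈ L ↔
      s.map (Function.Embedding.subtype _) ∈ K

/-- `K ≅ L` for simplicial complexes. -/
def Isomorphic {α β : Type*} (K : PreAbstractSimplicialComplex α)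
    (L : PreAbstractSimplicialComplex β) : Prop :=
  ∃ e : K.vertices ≃ L.vertices, IsIsomorphism e

/-- The automorphism group of a simplicial complex, under composition. -/
def Aut {α : Type*} (K : PreAbstractSimplicialComplex α) :
    Subgroup (Equiv.Perm K.vertices) where
  carrier := {e | IsIsomorphism e}
  one_mem' := by
    intro s
    have h : s.map (Equiv.toEmbedding (1 : Equiv.Perm K.vertices)) = s :=
      Finset.map_refl
    rw [h]
  mul_mem' := by
    intro a b ha hb s
    have h : s.map (Equiv.toEmbedding (a * b)) =
        (s.map (Equiv.toEmbedding b)).map (Equiv.toEmbedding a) := by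
      rw [Finset.map_map]; rfl
    rw [h]
    exact (ha _).trans (hb s)
  inv_mem' := by
    intro a ha s
    have h : (s.map (Equiv.toEmbedding a⁻¹)).map (Equiv.toEmbedding a) = s := by
      rw [Finset.map_map]
      ext x; simp
    have h2 := ha (s.map (Equiv.toEmbedding a⁻¹))
    rw [h] at h2
    exact h2.symm

/-- The underlying graph (1-skeleton) of a complex. -/
def oneSkeleton {α : Type*} (K : PreAbstractSimplicialComplex α) : SimpleGraph K.vertices where
  Adj v w := v ≠ w ∧ ∃ s ∈ K, (v : α) ∈ s ∧ (w : α) ∈ s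
  symm := ⟨fun _ _ h => ⟨h.1.symm, h.2.imp fun _ hs => ⟨hs.1, hs.2.2, hs.2.1⟩⟩⟩
  loopless := ⟨fun _ h => h.1 rfl⟩

/-- A complex is connected if it is non-empty and any two vertices are joined by an edge path. -/
def IsConnected {α : Type*} (K : PreAbstractSimplicialComplex α) : Prop :=
  K.oneSkeleton.Connected

/-- The disjoint union of two complexes. -/
def disjUnion {α β : Type*} (K : PreAbstractSimplicialComplex α)
    (L : PreAbstractSimplicialComplex β) : PreAbstractSimplicialComplex (α ⊕ β) where
  faces := {s | (∃ t ∈ K, s = t.map Function.Embedding.inl) ∨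
    (∃ t ∈ L, s = t.map Function.Embedding.inr)}
  isRelLowerSet_faces := by
    rintro s (⟨t, ht, rfl⟩ | ⟨t, ht, rfl⟩)
    · refine ⟨(K.isRelLowerSet_faces ht).1.map, fun u hu hne => Or.inl ?_⟩
      obtain ⟨u', hu', rfl⟩ := Finset.subset_map_iff.1 hu
      exact ⟨u', (K.isRelLowerSet_faces ht).2 hu' (Finset.map_nonempty.1 hne), rfl⟩
    · refine ⟨(L.isRelLowerSet_faces ht).1.map, fun u hu hne => Or.inr ?_⟩
      obtain ⟨u', hu', rfl⟩ := Finset.subset_map_iff.1 hu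
      exact ⟨u', (L.isRelLowerSet_faces ht).2 hu' (Finset.map_nonempty.1 hne), rfl⟩

/-- The join `K * L`: its simplices are the non-empty unions of a simplex of `K` or the empty set
with a simplex of `L` or the empty set. -/
def join {α β : Type*} (K : PreAbstractSimplicialComplex α)
    (L : PreAbstractSimplicialComplex β) : PreAbstractSimplicialComplex (α ⊕ β) where
  faces := {s | s.Nonempty ∧ (s.toLeft = ∅ ∨ s.toLeft ∈ K) ∧ (s.toRight = ∅ ∨ s.toRight ∈ L)}
  isRelLowerSet_faces := by
    rintro s ⟨hs, hK, hL⟩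
    refine ⟨hs, fun t hts hne => ⟨hne, ?_, ?_⟩⟩
    · have hsub : t.toLeft ⊆ s.toLeft := Finset.toLeft_subset_toLeft hts
      rcases t.toLeft.eq_empty_or_nonempty with h | h
      · exact Or.inl h
      · rcases hK with hK | hK
        · exact Or.inl (Finset.subset_empty.1 (hK ▸ hsub))
        · exact Or.inr ((K.isRelLowerSet_faces hK).2 hsub h)
    · have hsub : t.toRight ⊆ s.toRight := Finset.toRight_subset_toRight hts
      rcases t.toRight.eq_empty_or_nonempty with h | h
      · exact Or.inl h
      · rcases hL with hL | hL
        · exact Or.inl (Finset.subset_empty.1 (hL ▸ hsub))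
        · exact Or.inr ((L.isRelLowerSet_faces hL).2 hsub h)

/-- `K - U`: the simplices of `K` that contain no vertex of `U`. -/
def deletion {α : Type*} (K U : PreAbstractSimplicialComplex α) :
    PreAbstractSimplicialComplex α where
  faces := {s | s ∈ K ∧ ∀ v ∈ s, v ∉ U.vertices}
  isRelLowerSet_faces := fun _ hs =>
    ⟨(K.isRelLowerSet_faces hs.1).1, fun _ hts hne =>
      ⟨(K.isRelLowerSet_faces hs.1).2 hts hne, fun v hv => hs.2 v (hts hv)⟩⟩

/-- A subcomplex `U ≤ K` is fully connected in `K` if `K ≅ U * (K - U)`. -/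
def IsFullyConnected {α : Type*} (U K : PreAbstractSimplicialComplex α) : Prop :=
  U ≤ K ∧ Isomorphic K (join U (deletion K U))

/-- The boundary `∂Δⁿ` of the `n`-simplex: all non-empty proper subsets of an `(n+1)`-element
set. -/
def simplexBoundary (n : ℕ) : PreAbstractSimplicialComplex (Fin (n + 1)) where
  faces := {s | s.Nonempty ∧ s ≠ Finset.univ}
  isRelLowerSet_faces := fun _ hs =>
    ⟨hs.1, fun _ hts hne =>
      ⟨hne, fun h => hs.2 (Finset.univ_subset_iff.1 (h ▸ hts))⟩⟩

/-- The cycle `C_n` (for `n ≥ 3`): vertices are the residues mod `n`, edges are `{i, i + 1}`. -/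
def cycle (n : ℕ) : PreAbstractSimplicialComplex (ZMod n) where
  faces := {s | s.Nonempty ∧ ∃ i : ZMod n, s ⊆ {i, i + 1}}
  isRelLowerSet_faces := fun _ hs =>
    ⟨hs.1, fun _ hts hne => ⟨hne, hs.2.imp fun _ hi => hts.trans hi⟩⟩

/-- A discrete vector field on `K`: a set of pairs `(σ, τ)` of simplices of `K` with `σ` a
codimension-one face of `τ`, such that each simplex lies in at most one pair. -/
def IsDiscreteVectorField {α : Type*} (K : PreAbstractSimplicialComplex α)
    (V : Finset (Finset α × Finset α)) : Prop :=
  (∀ p ∈ V, p.1 ∈ K ∧ p.2 ∈ K ∧ p.1 ⊆ p.2 ∧ p.2.card = p.1.card + 1) ∧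
  ∀ p ∈ V, ∀ q ∈ V, ∀ ρ : Finset α, (ρ = p.1 ∨ ρ = p.2) → (ρ = q.1 ∨ ρ = q.2) → p = q

/-- `a 0, b 0, a 1, b 1, …, b (k - 1), a k` is a `V`-path of length `k`. (Only these entries of the
sequences `a` and `b` matter.) -/
def IsVPath {α : Type*} (V : Finset (Finset α × Finset α)) (k : ℕ) (a b : ℕ → Finset α) : Prop :=
  ∀ i < k, (a i, b i) ∈ V ∧ a (i + 1) ⊆ b i ∧ (a (i + 1)).card = (a i).card ∧ a (i + 1) ≠ a i

/-- A gradient vector field: a discrete vector field without non-trivial closed `V`-paths. -/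
def IsGradientVectorField {α : Type*} (K : PreAbstractSimplicialComplex α)
    (V : Finset (Finset α × Finset α)) : Prop :=
  IsDiscreteVectorField K V ∧ ∀ k a b, 0 < k → IsVPath V k a b → a k ≠ a 0

/-- The Morse complex `M(K)`: its `n`-simplices are the gradient vector fields on `K` with `n + 1`
regular pairs, so that its vertices are the primitive gradient vector fields, each identified with
its only regular pair. -/
def morseComplex {α : Type*} (K : PreAbstractSimplicialComplex α) :
    PreAbstractSimplicialComplex (Finset α × Finset α) where
  faces := {V | V.Nonempty ∧ IsGradientVectorField K V}
  isRelLowerSet_faces := fun _ hV =>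
    ⟨hV.1, fun _ hW hne =>
      ⟨hne, ⟨fun p hp => hV.2.1.1 p (hW hp),
        fun p hp q hq => hV.2.1.2 p (hW hp) q (hW hq)⟩,
        fun k a b hk h => hV.2.2 k a b hk fun i hi => ⟨hW (h i hi).1, (h i hi).2⟩⟩⟩

end PreAbstractSimplicialComplex

/-!
The vertices of the Morse complex of `K` are the edges of the Hasse diagram of `K`, and two of them
span an edge of the Morse complex exactly when they have no simplex in common
(`pair_mem_morseComplex_iff`). So an automorphism of the Morse complex is in particular an
automorphism of the line graph of the Hasse diagram.

For `K₁ ⊔ K₂` with both `Kᵢ` connected, this line graph has (at most) two connected components, the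
pairs of `K₁` and the pairs of `K₂` (`HassePair.induction`), which an automorphism preserves or
exchanges. The proof is completed by a reconstruction theorem
(`exists_isIsomorphism_of_meets_iff`): if a connected `K` is neither a simplex boundary nor a cycle,
then each isomorphism from the line graph of its Hasse diagram to that of another connected complex
comes from an isomorphism of complexes. If the components were exchanged, then `K₁ ≅ K₂`, which is
excluded because each complex is fully connected in itself. If they are preserved, then the
automorphism comes from automorphisms of `K₁` and `K₂`, and conversely these act on the Morse
complex (`autProdToMorse`).

The reconstruction theorem has three steps.

* A Hasse diagram is triangle-free, so Whitney's theorem applies (`exists_equiv`): an isomorphism of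
  line graphs is induced by an isomorphism `φ` of Hasse diagrams as undirected graphs
  (`exists_hasseIso`).
* `φ` preserves dimensions (`HasseIso.card_f`). The Hasse diagram of a simplex `τ` of dimension at
  least two is a cube without one vertex, and the Hasse diagram of the target sits in a cube as
  well, so `φ` maps the faces of `τ` to a subcube without one vertex. This leaves two cases:
  `φ` either preserves or reverses all inclusions among the faces of `τ` (`preserves_or_reverses`).
  One instance of reversal spreads over the connected complex `K`, and forces all links to be
  simplex boundaries of the same dimension, whence `K` is a simplex boundary
  (`isomorphic_simplexBoundary_of_three_le`). Without any reversal, `φ` can only fail to preserve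
  dimensions by exchanging all vertices with all edges of a graph. As an edge has two ends, each
  vertex then has degree two, and `K` is a cycle (`isomorphic_cycle_of_card_eq_two`).
* A dimension preserving `φ` is determined by its action on vertices
  (`HasseIso.exists_isIsomorphism`).
-/

namespace PreAbstractSimplicialComplex

/-! ### Line graphs of triangle-free graphs -/

/-- The incidence relation of a simple graph with edge set `E` and vertex set `V` which is
triangle-free, has no isolated vertices and no component consisting of a single edge. -/
structure IsTriangleFreeIncidence {V E : Type*} (I : E → V → Prop) : Prop where
  two_ends : ∀ e, ∃ a b, a ≠ b ∧ ∀ v, I e v ↔ v = a ∨ v = b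
  linear : ∀ {e e' v w}, v ≠ w → I e v → I e w → I e' v → I e' w → e = e'
  triangle_free : ∀ e₁ e₂ e₃, (∃ v, I e₁ v ∧ I e₂ v) → (∃ v, I e₁ v ∧ I e₃ v) →
    (∃ v, I e₂ v ∧ I e₃ v) → ∃ v, I e₁ v ∧ I e₂ v ∧ I e₃ v
  exists_edge : ∀ v, ∃ e, I e v
  exists_adj : ∀ e, ∃ e', e' ≠ e ∧ ∃ v, I e v ∧ I e' v

namespace IsTriangleFreeIncidence

variable {V E W D : Type*} {I : E → V → Prop} {J : D → W → Prop}

lemma eq_of_common (hI : IsTriangleFreeIncidence I) {e e' : E} {v w : V} (he : e ≠ e')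
    (h₁ : I e v) (h₂ : I e' v) (h₃ : I e w) (h₄ : I e' w) : v = w := by
  by_contra h
  exact he (hI.linear h h₁ h₃ h₂ h₄)

/-- Distinct vertices have distinct stars, since no edge is a component. -/
lemma eq_of_star_eq (hI : IsTriangleFreeIncidence I) {v w : V} (h : ∀ e, I e v ↔ I e w) :
    v = w := by
  by_contra hne
  obtain ⟨e, he⟩ := hI.exists_edge v
  have hew := (h e).1 he
  obtain ⟨e', hne', u, hu, hu'⟩ := hI.exists_adj e
  obtain ⟨a, b, -, hab⟩ := hI.two_ends e
  have huvw : u = v ∨ u = w := by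
    have h1 := (hab u).1 hu
    have h2 := (hab v).1 he
    have h3 := (hab w).1 hew
    grind
  have h1 : I e' v ∧ I e' w := by
    rcases huvw with rfl | rfl
    · exact ⟨hu', (h _).1 hu'⟩
    · exact ⟨(h _).2 hu', hu'⟩
  exact hne' (hI.linear hne h1.1 h1.2 he hew)

/-- Three edges at a vertex pairwise meet; absent triangles, so do their images, at one vertex. -/
lemma exists_forall_of_two_edges (hJ : IsTriangleFreeIncidence J)
    (F : E ≃ D) (hF : ∀ p q, (∃ v, I p v ∧ I q v) ↔ ∃ w, J (F p) w ∧ J (F q) w)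
    {v : V} {e₁ e₂ : E} (hne : e₁ ≠ e₂) (h₁ : I e₁ v) (h₂ : I e₂ v) :
    ∃ w, ∀ e, I e v → J (F e) w := by
  obtain ⟨w, hw₁, hw₂⟩ := (hF e₁ e₂).1 ⟨v, h₁, h₂⟩
  refine ⟨w, fun e he => ?_⟩
  obtain ⟨w', h1, h2, h3⟩ := hJ.triangle_free (F e₁) (F e₂) (F e) ⟨w, hw₁, hw₂⟩
    ((hF _ _).1 ⟨v, h₁, he⟩) ((hF _ _).1 ⟨v, h₂, he⟩)
  rwa [hJ.eq_of_common (F.injective.ne hne) hw₁ hw₂ h1 h2]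

lemma exists_forall_iff_of_two_edges (hI : IsTriangleFreeIncidence I)
    (hJ : IsTriangleFreeIncidence J)
    (F : E ≃ D) (hF : ∀ p q, (∃ v, I p v ∧ I q v) ↔ ∃ w, J (F p) w ∧ J (F q) w)
    {v : V} {e₁ e₂ : E} (hne : e₁ ≠ e₂) (h₁ : I e₁ v) (h₂ : I e₂ v) :
    ∃ w, ∀ e, I e v ↔ J (F e) w := by
  obtain ⟨w, hw⟩ := exists_forall_of_two_edges hJ F hF hne h₁ h₂
  have hF' : ∀ p q, (∃ v, J p v ∧ J q v) ↔ ∃ w, I (F.symm p) w ∧ I (F.symm q) w := by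
    intro p q; rw [hF]; simp
  obtain ⟨v', hv'⟩ := exists_forall_of_two_edges hI F.symm hF' (F.injective.ne hne)
    (hw _ h₁) (hw _ h₂)
  have hvv' : v = v' := hI.eq_of_common hne h₁ h₂ (by simpa using hv' _ (hw _ h₁))
    (by simpa using hv' _ (hw _ h₂))
  refine ⟨w, fun e => ⟨hw e, fun he => ?_⟩⟩
  simpa [hvv'] using hv' _ he

lemma exists_forall_iff (hI : IsTriangleFreeIncidence I) (hJ : IsTriangleFreeIncidence J)
    (F : E ≃ D) (hF : ∀ p q, (∃ v, I p v ∧ I q v) ↔ ∃ w, J (F p) w ∧ J (F q) w) (v : V) :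
    ∃ w, ∀ e, I e v ↔ J (F e) w := by
  obtain ⟨e, he⟩ := hI.exists_edge v
  by_cases h : ∃ e', e' ≠ e ∧ I e' v
  · obtain ⟨e', hne, he'⟩ := h
    exact exists_forall_iff_of_two_edges hI hJ F hF hne he' he
  push Not at h
  -- `v` has degree one, so the other end `u` of its edge `e` has degree at least two.
  obtain ⟨e', hne', u, hu, hu'⟩ := hI.exists_adj e
  obtain ⟨x, hx⟩ := exists_forall_iff_of_two_edges hI hJ F hF hne' hu' hu
  have huv : u ≠ v := by rintro rfl; exact h e' hne' hu'
  obtain ⟨w, hwx, hw⟩ : ∃ w, w ≠ x ∧ J (F e) w := by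
    obtain ⟨a, b, hab, h2⟩ := hJ.two_ends (F e)
    by_cases hax : a = x
    · exact ⟨b, by rintro rfl; exact hab hax, (h2 b).2 (Or.inr rfl)⟩
    · exact ⟨a, hax, (h2 a).2 (Or.inl rfl)⟩
  refine ⟨w, fun d => ⟨fun hd => ?_, fun hd => ?_⟩⟩
  · by_cases hde : d = e
    · rwa [hde]
    · exact absurd hd (h d hde)
  · by_cases hde : d = e
    · rwa [hde]
    exfalso
    have hF' : ∀ p q, (∃ v, J p v ∧ J q v) ↔ ∃ w, I (F.symm p) w ∧ I (F.symm q) w := by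
      intro p q; rw [hF]; simp
    obtain ⟨v', hv'⟩ := exists_forall_iff_of_two_edges hJ hI F.symm hF'
      (F.injective.ne hde) hd hw
    have h1 : I e v' := by simpa using (hv' _).1 hw
    have h2 : I d v' := by simpa using (hv' _).1 hd
    have hv'u : v' = u := by
      obtain ⟨a, b, -, hab⟩ := hI.two_ends e
      have h3 := (hab u).1 hu
      have h4 := (hab v).1 he
      have h5 := (hab v').1 h1
      have : v' ≠ v := by rintro rfl; exact h d hde h2
      grind
    subst hv'u
    have h6 : J (F e') w := (hv' _).2 (by simpa using hu')
    exact hne' (F.injective (hJ.linear hwx h6 ((hx _).1 hu') hw ((hx _).1 hu)))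

/-- **Whitney's theorem** for triangle-free graphs: an isomorphism of line graphs is induced by an
isomorphism of graphs. -/
theorem exists_equiv (hI : IsTriangleFreeIncidence I) (hJ : IsTriangleFreeIncidence J)
    (F : E ≃ D) (hF : ∀ p q, (∃ v, I p v ∧ I q v) ↔ ∃ w, J (F p) w ∧ J (F q) w) :
    ∃ φ : V ≃ W, ∀ e v, J (F e) (φ v) ↔ I e v := by
  have hF' : ∀ p q, (∃ v, J p v ∧ J q v) ↔ ∃ w, I (F.symm p) w ∧ I (F.symm q) w := by
    intro p q; rw [hF]; simp
  choose φ hφ using exists_forall_iff hI hJ F hF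
  choose ψ hψ using exists_forall_iff hJ hI F.symm hF'
  refine ⟨⟨φ, ψ, fun v => ?_, fun w => ?_⟩, fun e v => (hφ v e).symm⟩
  · refine hI.eq_of_star_eq fun e => ?_
    rw [hφ v, hψ]; simp
  · refine hJ.eq_of_star_eq fun e => ?_
    rw [hψ w, hφ]; simp

end IsTriangleFreeIncidence

/-! ### Isomorphisms of Hasse diagrams -/

open scoped symmDiff

lemma nonempty_of_mem {α : Type*} {K : PreAbstractSimplicialComplex α} {s : Finset α}
    (hs : s ∈ K) : s.Nonempty :=
  (K.isRelLowerSet_faces hs).1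

lemma mem_of_subset {α : Type*} {K : PreAbstractSimplicialComplex α} {s t : Finset α}
    (hs : s ∈ K) (hts : t ⊆ s) (ht : t.Nonempty) : t ∈ K :=
  (K.isRelLowerSet_faces hs).2 hts ht

lemma singleton_mem {α : Type*} {K : PreAbstractSimplicialComplex α} {s : Finset α}
    (hs : s ∈ K) {a : α} (ha : a ∈ s) : {a} ∈ K :=
  mem_of_subset hs (by simpa using ha) (by simp)

/-- `s` is a codimension-one face of `t`. -/
def Covers {α : Type*} (s t : Finset α) : Prop := s ⊆ t ∧ t.card = s.card + 1

/-- Adjacency in the Hasse diagram, that is, in the undirected graph of the covering relation. -/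
def HasseAdj {α : Type*} (s t : Finset α) : Prop := Covers s t ∨ Covers t s

lemma HasseAdj.symm {α : Type*} {s t : Finset α} (h : HasseAdj s t) : HasseAdj t s := Or.symm h

lemma HasseAdj.ne {α : Type*} {s t : Finset α} (h : HasseAdj s t) : s ≠ t := by
  rintro rfl
  rcases h with h | h <;> have := h.2 <;> omega

/-- Neighbours in the Hasse diagram differ in exactly one element, as in a hypercube graph. -/
lemma hasseAdj_iff {α : Type*} [DecidableEq α] {s t : Finset α} :
    HasseAdj s t ↔ ∃ a, t = s ∆ {a} := by
  constructor
  · rintro (⟨h, hc⟩ | ⟨h, hc⟩)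
    · obtain ⟨a, ha⟩ : ∃ a, t \ s = {a} := Finset.card_eq_one.1 (by
        rw [Finset.card_sdiff_of_subset h]; omega)
      refine ⟨a, ?_⟩
      ext x
      have h1 : x ∈ t \ s ↔ x = a := by rw [ha]; simp
      have := @h x
      simp only [Finset.mem_sdiff, Finset.mem_symmDiff, Finset.mem_singleton] at *
      grind
    · obtain ⟨a, ha⟩ : ∃ a, s \ t = {a} := Finset.card_eq_one.1 (by
        rw [Finset.card_sdiff_of_subset h]; omega)
      refine ⟨a, ?_⟩
      ext x
      have h1 : x ∈ s \ t ↔ x = a := by rw [ha]; simp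
      have := @h x
      simp only [Finset.mem_sdiff, Finset.mem_symmDiff, Finset.mem_singleton] at *
      grind
  · rintro ⟨a, rfl⟩
    by_cases ha : a ∈ s
    · have h : s ∆ {a} = s.erase a := by
        ext x; simp only [Finset.mem_symmDiff, Finset.mem_singleton, Finset.mem_erase]; grind
      rw [h]
      exact Or.inr ⟨Finset.erase_subset _ _, by rw [Finset.card_erase_add_one ha]⟩
    · have h : s ∆ {a} = insert a s := by
        ext x; simp only [Finset.mem_symmDiff, Finset.mem_singleton, Finset.mem_insert]; grind
      rw [h]
      exact Or.inl ⟨Finset.subset_insert _ _, by rw [Finset.card_insert_of_notMem ha]⟩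

/-- In a hypercube, two vertices with a common neighbour `U` have at most one other. -/
lemma eq_symmDiff_of_hasseAdj {α : Type*} [DecidableEq α] {U P : Finset α} {x y : α} (hxy : x ≠ y)
    (hx : HasseAdj (U ∆ {x}) P) (hy : HasseAdj (U ∆ {y}) P) (hP : P ≠ U) :
    P = U ∆ {x, y} := by
  obtain ⟨p, hp⟩ := hasseAdj_iff.1 hx
  obtain ⟨q, hq⟩ := hasseAdj_iff.1 hy
  have hpx : p ≠ x := by
    rintro rfl
    exact hP (by rw [hp, symmDiff_symmDiff_cancel_right])
  have hpq : ({x} ∆ {p} : Finset α) = {y} ∆ {q} := by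
    rw [symmDiff_assoc] at hp hq
    exact symmDiff_right_injective U (hp.symm.trans hq)
  have hpy : p = y := by
    have h1 := Finset.ext_iff.1 hpq p
    have h2 := Finset.ext_iff.1 hpq x
    simp only [Finset.mem_symmDiff, Finset.mem_singleton] at h1 h2
    grind
  rw [hp, hpy, symmDiff_assoc]
  congr 1
  ext z
  simp only [Finset.mem_symmDiff, Finset.mem_singleton, Finset.mem_insert]
  grind

/-- An isomorphism of the Hasse diagrams (as undirected graphs) of two complexes. The maps `f` and
`g` matter on faces only. -/
structure HasseIso {α β : Type*} (K : PreAbstractSimplicialComplex α)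
    (L : PreAbstractSimplicialComplex β) where
  f : Finset α → Finset β
  g : Finset β → Finset α
  f_mem : ∀ {s}, s ∈ K → f s ∈ L
  g_mem : ∀ {t}, t ∈ L → g t ∈ K
  g_f : ∀ {s}, s ∈ K → g (f s) = s
  f_g : ∀ {t}, t ∈ L → f (g t) = t
  f_adj : ∀ {s t}, s ∈ K → t ∈ K → HasseAdj s t → HasseAdj (f s) (f t)
  g_adj : ∀ {s t}, s ∈ L → t ∈ L → HasseAdj s t → HasseAdj (g s) (g t)

namespace HasseIso

variable {α β : Type*} {K : PreAbstractSimplicialComplex α} {L : PreAbstractSimplicialComplex β}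

/-- The inverse isomorphism. -/
def symm (φ : HasseIso K L) : HasseIso L K :=
  ⟨φ.g, φ.f, φ.g_mem, φ.f_mem, φ.f_g, φ.g_f, φ.g_adj, φ.f_adj⟩

lemma f_inj (φ : HasseIso K L) {s t : Finset α} (hs : s ∈ K) (ht : t ∈ K) (h : φ.f s = φ.f t) :
    s = t := by
  rw [← φ.g_f hs, ← φ.g_f ht, h]

variable [DecidableEq α] [DecidableEq β]

/-- On the faces of a simplex `τ` of dimension at least two, whose Hasse diagram is a cube without
one vertex, `φ` is given by a map of directions `c`. -/
lemma exists_cube (φ : HasseIso K L) {τ : Finset α} (hτ : τ ∈ K) (h3 : 3 ≤ τ.card) :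
    ∃ c : α → β, Set.InjOn c τ ∧
      ∀ A ⊆ τ, A ≠ τ → φ.f (τ \ A) = φ.f τ ∆ A.image c := by
  have hmem : ∀ A ⊆ τ, A ≠ τ → τ \ A ∈ K := fun A hA hne =>
    mem_of_subset hτ Finset.sdiff_subset (by
      rw [Finset.sdiff_nonempty]
      exact fun h => hne (hA.antisymm h))
  have hcard : ∀ A ⊆ τ, A.card ≤ 2 → A ≠ τ := by
    rintro A hA h rfl; omega
  have hadj : ∀ A ⊆ τ, ∀ a ∈ τ, a ∉ A → HasseAdj (τ \ A) (τ \ insert a A) := by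
    intro A hA a ha haA
    refine hasseAdj_iff.2 ⟨a, ?_⟩
    ext x
    simp only [Finset.mem_symmDiff, Finset.mem_singleton, Finset.mem_insert, Finset.mem_sdiff]
    grind
  have hsing : ∀ a ∈ τ, ∃ b, φ.f (τ \ {a}) = φ.f τ ∆ {b} := by
    intro a ha
    have h1 : τ \ {a} ∈ K := hmem {a} (by simpa using ha) (hcard _ (by simpa using ha) (by simp))
    have h2 := hadj ∅ (by simp) a ha (by simp)
    rw [Finset.sdiff_empty] at h2
    exact hasseAdj_iff.1 (φ.f_adj hτ h1 h2)
  obtain ⟨a₀, ha₀⟩ : τ.Nonempty := nonempty_of_mem hτ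
  obtain ⟨b₀, -⟩ := hsing a₀ ha₀
  have : ∀ a, ∃ b, a ∈ τ → φ.f (τ \ {a}) = φ.f τ ∆ {b} := by
    intro a
    by_cases ha : a ∈ τ
    · exact (hsing a ha).imp fun b hb _ => hb
    · exact ⟨b₀, fun h => absurd h ha⟩
  choose c hc using this
  have hinj : Set.InjOn c τ := by
    intro a ha b hb hab
    have ha' : a ∈ τ := ha
    have hb' : b ∈ τ := hb
    have h := φ.f_inj (hmem {a} (by simpa using ha) (hcard _ (by simpa using ha) (by simp)))
      (hmem {b} (by simpa using hb) (hcard _ (by simpa using hb) (by simp)))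
      ((hc a ha).trans (by rw [hab, hc b hb]))
    have h1 := Finset.ext_iff.1 h a
    simp only [Finset.mem_sdiff, Finset.mem_singleton] at h1
    grind
  refine ⟨c, hinj, ?_⟩
  intro A
  induction hn : A.card using Nat.strong_induction_on generalizing A with
  | _ n ih =>
    intro hA hne
    rcases Nat.lt_or_ge 1 A.card with h1 | h1
    -- The face `τ \ A` is the second common neighbour of `τ \ (A \ {a})` and `τ \ (A \ {b})`, next
    -- to `τ \ (A \ {a, b})`, so its image is determined by the images of these three.
    · obtain ⟨a, ha, b, hb, hab⟩ := Finset.one_lt_card.1 h1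
      have haτ := hA ha
      have hbτ := hA hb
      set B := (A.erase a).erase b with hB
      have hBA : B ⊆ A := (Finset.erase_subset _ _).trans (Finset.erase_subset _ _)
      have hAB : A = insert a (insert b B) := by
        ext x; simp only [hB, Finset.mem_insert, Finset.mem_erase]; grind
      have haB : a ∉ B := by simp [hB]
      have hbB : b ∉ B := by simp [hB]
      have hBτ := hBA.trans hA
      have e1 : A.erase b = insert a B := by
        ext x; simp only [hB, Finset.mem_insert, Finset.mem_erase]; grind
      have e2 : A.erase a = insert b B := by
        ext x; simp only [hB, Finset.mem_insert, Finset.mem_erase]; grind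
      have proper : ∀ C ⊆ A, C ≠ τ := fun C hC h => hne (hA.antisymm (h ▸ hC))
      have c1 : (insert a B).card < A.card := by
        rw [← e1]; exact Finset.card_erase_lt_of_mem hb
      have c2 : (insert b B).card < A.card := by
        rw [← e2]; exact Finset.card_erase_lt_of_mem ha
      have c0 : B.card < A.card := (Finset.card_lt_card (Finset.ssubset_insert haB)).trans c1
      have s1 : insert a B ⊆ A := by rw [← e1]; exact Finset.erase_subset _ _
      have s2 : insert b B ⊆ A := by rw [← e2]; exact Finset.erase_subset _ _
      have i0 := ih _ (hn ▸ c0) B rfl hBτ (proper _ hBA)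
      have i1 := ih _ (hn ▸ c1) _ rfl (s1.trans hA) (proper _ s1)
      have i2 := ih _ (hn ▸ c2) _ rfl (s2.trans hA) (proper _ s2)
      have himg : ∀ d ∈ τ, ∀ C ⊆ τ, d ∉ C → (insert d C).image c = C.image c ∆ {c d} := by
        intro d hd C hC hdC
        have : c d ∉ C.image c := by
          intro h
          obtain ⟨y, hy, hyd⟩ := Finset.mem_image.1 h
          exact hdC (hinj (hC hy) hd hyd ▸ hy)
        rw [Finset.image_insert]
        ext x
        simp only [Finset.mem_symmDiff, Finset.mem_singleton, Finset.mem_insert]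
        grind
      rw [himg a haτ B hBτ haB, ← symmDiff_assoc, ← i0] at i1
      rw [himg b hbτ B hBτ hbB, ← symmDiff_assoc, ← i0] at i2
      have m := hmem A hA hne
      have a1 := φ.f_adj (hmem _ (s1.trans hA) (proper _ s1)) m (by
        have := hadj (insert a B) (s1.trans hA) b hbτ (by simp [hab.symm, hbB])
        rwa [Finset.insert_comm, ← hAB] at this)
      have a2 := φ.f_adj (hmem _ (s2.trans hA) (proper _ s2)) m (by
        have := hadj (insert b B) (s2.trans hA) a haτ (by simp [hab, haB])
        rwa [← hAB] at this)
      rw [i1] at a1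
      rw [i2] at a2
      have hcab : c a ≠ c b := fun h => hab (hinj haτ hbτ h)
      rw [eq_symmDiff_of_hasseAdj hcab a1 a2, i0, symmDiff_assoc]
      · congr 1
        rw [hAB, himg a haτ _ (s2.trans hA) (by simp [hab, haB]), himg b hbτ B hBτ hbB,
          symmDiff_assoc]
        congr 1
        ext z
        simp only [Finset.mem_symmDiff, Finset.mem_singleton, Finset.mem_insert]
        grind
      · intro h
        have h1 := Finset.ext_iff.1 (φ.f_inj m (hmem _ hBτ (proper _ hBA)) h) a
        simp only [Finset.mem_sdiff] at h1
        grind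
    · rcases Nat.lt_or_ge 0 A.card with h0 | h0
      · obtain ⟨a, rfl⟩ := Finset.card_eq_one.1 (le_antisymm h1 h0)
        rw [hc a (by simpa using hA)]
        simp
      · have : A = ∅ := Finset.card_eq_zero.1 (by omega)
        subst this
        have h : φ.f τ ∆ ∅ = φ.f τ := symmDiff_bot _
        simp [h]

/-- `φ` preserves inclusions among the faces of `τ`, and is induced by the map of vertices `c`. -/
def Preserves (φ : HasseIso K L) (τ : Finset α) (c : α → β) : Prop :=
  ∀ s ⊆ τ, s.Nonempty → φ.f s = s.image c

/-- `φ` reverses inclusions among the faces of `τ`, which it maps to the simplices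
`φ(τ) ∪ c(A)` for the proper subsets `A` of `τ`. -/
def Reverses (φ : HasseIso K L) (τ : Finset α) (c : α → β) : Prop :=
  Disjoint (φ.f τ) (τ.image c) ∧ φ.f τ ∪ τ.image c ∉ L ∧
    ∀ A ⊆ τ, A ≠ τ → φ.f (τ \ A) = φ.f τ ∪ A.image c

theorem preserves_or_reverses (φ : HasseIso K L) {τ : Finset α} (hτ : τ ∈ K) (h3 : 3 ≤ τ.card) :
    ∃ c : α → β, Set.InjOn c τ ∧ (φ.Preserves τ c ∨ φ.Reverses τ c) := by
  obtain ⟨c, hinj, hc⟩ := φ.exists_cube hτ h3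
  refine ⟨c, hinj, ?_⟩
  set X := φ.f τ with hX
  have hXL : X ∈ L := φ.f_mem hτ
  -- The missing vertex of the cube is not a face: it would be a neighbour of `φ {v}` for each of
  -- the at least three `v ∈ τ`, while an edge has just two vertices.
  have hZ : X ∆ τ.image c ∉ L := by
    intro hZL
    have key : τ ⊆ φ.g (X ∆ τ.image c) ∧ (φ.g (X ∆ τ.image c)).card = 2 := by
      have h1 : ∀ v ∈ τ, v ∈ φ.g (X ∆ τ.image c) ∧ (φ.g (X ∆ τ.image c)).card = 2 := by
        intro v hv
        have hvK := singleton_mem hτ hv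
        have h2 := hc (τ.erase v) (Finset.erase_subset _ _) (Finset.erase_ssubset hv).ne
        have h3 : τ \ τ.erase v = {v} := by
          ext x; simp only [Finset.mem_sdiff, Finset.mem_erase, Finset.mem_singleton]; grind
        rw [h3] at h2
        have h4 : HasseAdj (φ.f {v}) (X ∆ τ.image c) := by
          rw [h2, hasseAdj_iff]
          refine ⟨c v, ?_⟩
          rw [symmDiff_assoc]
          congr 1
          have h5 : c v ∉ (τ.erase v).image c := by
            intro h
            obtain ⟨y, hy, hyv⟩ := Finset.mem_image.1 h
            have := hinj (Finset.erase_subset _ _ hy) hv hyv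
            exact (Finset.mem_erase.1 hy).1 this
          conv_lhs => rw [← Finset.insert_erase hv, Finset.image_insert]
          ext x
          simp only [Finset.mem_symmDiff, Finset.mem_singleton, Finset.mem_insert]
          grind
        have h5 := φ.g_adj (φ.f_mem hvK) hZL h4
        rw [φ.g_f hvK] at h5
        rcases h5 with ⟨h6, h7⟩ | ⟨h6, h7⟩
        · exact ⟨by simpa using h6, by simpa using h7⟩
        · have h8 := (nonempty_of_mem (φ.g_mem hZL)).card_pos
          rw [Finset.card_singleton] at h7
          omega
      obtain ⟨v, hv⟩ := nonempty_of_mem hτ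
      exact ⟨fun v hv => (h1 v hv).1, (h1 v hv).2⟩
    have := Finset.card_le_card key.1
    omega
  by_cases hd : Disjoint X (τ.image c)
  · right
    have hs : ∀ A ⊆ τ, X ∆ A.image c = X ∪ A.image c := fun A hA =>
      Finset.symmDiff_eq_union (hd.mono_right (Finset.image_subset_image hA))
    exact ⟨hd, hs τ subset_rfl ▸ hZ, fun A hA hne => (hc A hA hne).trans (hs A hA)⟩
  · left
    obtain ⟨d, hdX, hdc⟩ := Finset.not_disjoint_iff.1 hd
    obtain ⟨v, hv, rfl⟩ := Finset.mem_image.1 hdc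
    -- The union of `X` with all directions is a face, hence so would be the missing vertex of the
    -- cube, unless it is the empty set.
    have hT : X ∪ τ.image c ∈ L := by
      have hne : τ.filter (fun a => c a ∉ X) ≠ τ := by
        intro h
        rw [← h] at hv
        exact (Finset.mem_filter.1 hv).2 hdX
      have h1 := hc _ (Finset.filter_subset _ _) hne
      have h2 : X ∆ (τ.filter (fun a => c a ∉ X)).image c = X ∪ τ.image c := by
        ext x
        simp only [Finset.mem_symmDiff, Finset.mem_image, Finset.mem_filter, Finset.mem_union]
        grind
      rw [← h2, ← h1]
      exact φ.f_mem (mem_of_subset hτ Finset.sdiff_subset (by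
        rw [Finset.sdiff_nonempty]
        exact fun h => hne ((Finset.filter_subset _ _).antisymm h)))
    have hXc : X = τ.image c := by
      by_contra hne
      exact hZ (mem_of_subset hT Finset.symmDiff_subset_union (Finset.symmDiff_nonempty.2 hne))
    intro s hs hsne
    have h1 := hc (τ \ s) Finset.sdiff_subset (by
      intro h
      obtain ⟨x, hx⟩ := hsne
      have := Finset.ext_iff.1 h x
      simp only [Finset.mem_sdiff] at this
      have := hs hx
      grind)
    rw [Finset.sdiff_sdiff_eq_self hs] at h1
    rw [h1, hXc]
    ext x
    simp only [Finset.mem_symmDiff, Finset.mem_image, Finset.mem_sdiff]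
    constructor
    · grind
    · rintro ⟨a, ha, rfl⟩
      left
      refine ⟨⟨a, hs ha, rfl⟩, ?_⟩
      rintro ⟨b, ⟨hb, hbs⟩, hab⟩
      exact hbs (hinj hb (hs ha) hab ▸ ha)

end HasseIso

/-! ### Reversing isomorphisms and boundaries of simplices -/

/-- A property that is inherited by neighbours holds at all vertices of a connected complex once it
holds at one. -/
lemma IsConnected.induction {α : Type*} [DecidableEq α] {K : PreAbstractSimplicialComplex α}
    (hK : K.IsConnected) {P : α → Prop} (h : ∀ v w, v ≠ w → {v, w} ∈ K → P v → P w) {v w : α}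
    (hv : {v} ∈ K) (hw : {w} ∈ K) (hPv : P v) : P w := by
  obtain ⟨p⟩ := hK.preconnected ⟨v, hv⟩ ⟨w, hw⟩
  suffices ∀ x y : K.vertices, K.oneSkeleton.Walk x y → P x → P y from this _ _ p hPv
  intro x y q
  induction q with
  | nil => exact id
  | cons hadj _ ih =>
    intro hx
    obtain ⟨hne, s, hs, h1, h2⟩ := hadj
    refine ih (h _ _ (fun h => hne (Subtype.ext h)) (mem_of_subset hs ?_ (by simp)) hx)
    simp [Finset.insert_subset_iff, h1, h2]

/-- A complex whose faces are the non-empty proper subsets of `V` is a simplex boundary. -/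
lemma isomorphic_simplexBoundary {α : Type*} {K : PreAbstractSimplicialComplex α}
    {V : Finset α} {n : ℕ} (hcard : V.card = n + 1) (hn : n ≠ 0)
    (hK : ∀ s, s ∈ K ↔ s.Nonempty ∧ s ⊂ V) : K.Isomorphic (simplexBoundary n) := by
  have hvert : ∀ v, v ∈ K.vertices ↔ v ∈ V := by
    intro v
    change {v} ∈ K ↔ _
    rw [hK, Finset.ssubset_iff_subset_ne]
    simp only [Finset.singleton_nonempty, Finset.singleton_subset_iff, true_and,
      and_iff_left_iff_imp]
    rintro - rfl
    simp at hcard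
    omega
  have hvert' : ∀ i : Fin (n + 1), i ∈ (simplexBoundary n).vertices := by
    intro i
    refine ⟨by simp, fun h => ?_⟩
    have := congrArg Finset.card h
    simp at this
    omega
  let e₀ : V ≃ Fin (n + 1) := V.equivFinOfCardEq hcard
  let e : K.vertices ≃ (simplexBoundary n).vertices :=
    { toFun := fun v => ⟨e₀ ⟨v, (hvert v).1 v.2⟩, hvert' _⟩
      invFun := fun i => ⟨e₀.symm i, (hvert _).2 (e₀.symm i).2⟩
      left_inv := fun v => by simp
      right_inv := fun i => by simp }
  refine ⟨e, fun s => ?_⟩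
  rw [hK]
  change (Finset.Nonempty _ ∧ _ ≠ _) ↔ _
  rw [Finset.map_nonempty, Finset.map_nonempty, Finset.map_nonempty]
  refine and_congr_right fun _ => ?_
  rw [Finset.ssubset_iff_subset_ne, and_iff_right, not_iff_not]
  · rw [← Finset.card_eq_iff_eq_univ, Finset.card_map, Finset.card_map, Fintype.card_fin]
    have hsub : s.map (Function.Embedding.subtype _) ⊆ V := by
      intro x hx
      obtain ⟨y, -, rfl⟩ := Finset.mem_map.1 hx
      exact (hvert _).1 y.2
    constructor
    · intro h
      exact Finset.eq_of_subset_of_card_le hsub (by rw [Finset.card_map, h, hcard])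
    · intro h
      rw [← hcard, ← h, Finset.card_map]
  · intro x hx
    obtain ⟨y, -, rfl⟩ := Finset.mem_map.1 hx
    exact (hvert _).1 y.2

namespace HasseIso

variable {α β : Type*} [DecidableEq β]
  {K : PreAbstractSimplicialComplex α} {L : PreAbstractSimplicialComplex β}

lemma Preserves.card_f {φ : HasseIso K L} {τ : Finset α} {c : α → β} (h : φ.Preserves τ c)
    (hc : Set.InjOn c τ) {s : Finset α} (hs : s ⊆ τ) (hne : s.Nonempty) :
    (φ.f s).card = s.card := by
  rw [h s hs hne, Finset.card_image_of_injOn (hc.mono (by exact_mod_cast hs))]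

variable [DecidableEq α]

lemma Reverses.f_eq {φ : HasseIso K L} {τ : Finset α} {c : α → β} (h : φ.Reverses τ c)
    {s : Finset α} (hs : s ⊆ τ) (hne : s.Nonempty) : φ.f s = φ.f τ ∪ (τ \ s).image c := by
  rw [← h.2.2 (τ \ s) Finset.sdiff_subset, Finset.sdiff_sdiff_eq_self hs]
  intro h1
  obtain ⟨x, hx⟩ := hne
  have := Finset.ext_iff.1 h1 x
  simp only [Finset.mem_sdiff] at this
  exact (this.2 (hs hx)).2 hx

lemma Reverses.card_f {φ : HasseIso K L} {τ : Finset α} {c : α → β} (h : φ.Reverses τ c)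
    (hc : Set.InjOn c τ) {s : Finset α} (hs : s ⊆ τ) (hne : s.Nonempty) :
    (φ.f s).card + s.card = (φ.f τ).card + τ.card := by
  rw [h.f_eq hs hne, Finset.card_union_of_disjoint (h.1.mono_right
    (Finset.image_subset_image Finset.sdiff_subset)),
    Finset.card_image_of_injOn (hc.mono (by exact_mod_cast Finset.sdiff_subset)),
    Finset.card_sdiff_of_subset hs]
  have := Finset.card_le_card hs
  omega

/-- If a vertex `v` corresponds to a simplex of dimension at least two, then its link is the
boundary of a simplex. -/
lemma exists_star (φ : HasseIso K L) {v : α} (hv : {v} ∈ K) (h3 : 3 ≤ (φ.f {v}).card) :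
    ∃ E : Finset α, v ∉ E ∧ E.card = (φ.f {v}).card ∧
      ∀ s, v ∈ s → (s ∈ K ↔ s ⊂ insert v E) := by
  set Y := φ.f {v} with hY
  have hYL : Y ∈ L := φ.f_mem hv
  have hgY : φ.g Y = {v} := φ.g_f hv
  obtain ⟨c, hc, hP | hR⟩ := φ.symm.preserves_or_reverses hYL h3
  · have := hP.card_f hc subset_rfl (nonempty_of_mem hYL)
    change (φ.g Y).card = _ at this
    rw [hgY, Finset.card_singleton] at this
    omega
  obtain ⟨hdis, hnot, hfaces⟩ := hR
  change Disjoint (φ.g Y) _ at hdis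
  change φ.g Y ∪ _ ∉ K at hnot
  change ∀ A ⊆ Y, A ≠ Y → φ.g (Y \ A) = φ.g Y ∪ _ at hfaces
  rw [hgY] at hdis hnot hfaces
  have hvE : v ∉ Y.image c := Finset.disjoint_singleton_left.1 hdis
  have hYA : ∀ A ⊆ Y, A ≠ Y → Y \ A ∈ L := fun A hA hne =>
    mem_of_subset hYL Finset.sdiff_subset
      (Finset.sdiff_nonempty.2 fun h => hne (hA.antisymm h))
  have hne1 : ∀ y : β, ({y} : Finset β) ≠ Y := by
    rintro y h
    rw [← h] at h3
    simp at h3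
  have hedge : ∀ w, w ≠ v → {v, w} ∈ K → w ∈ Y.image c := by
    intro w hwv hw
    have hadj : HasseAdj Y (φ.f {v, w}) := φ.f_adj hv hw
      (Or.inl ⟨by simp, by rw [Finset.card_pair hwv.symm, Finset.card_singleton]⟩)
    obtain ⟨z, hz⟩ := hasseAdj_iff.1 hadj
    by_cases hzY : z ∈ Y
    · have h1 : Y ∆ {z} = Y \ {z} := by
        ext x; simp only [Finset.mem_symmDiff, Finset.mem_singleton, Finset.mem_sdiff]; grind
      have h2 := hfaces {z} (by simpa using hzY) (hne1 z)
      rw [← h1, ← hz, φ.g_f hw] at h2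
      have h3 : w ∈ {v} ∪ Finset.image c {z} := by rw [← h2]; simp
      simp only [Finset.image_singleton, Finset.mem_union, Finset.mem_singleton, hwv,
        false_or] at h3
      exact h3 ▸ Finset.mem_image_of_mem c hzY
    -- Otherwise the edge corresponds to a coface `insert z Y` of `Y`, and some triangle on it
    -- would neither preserve nor reverse inclusions.
    exfalso
    have hins : φ.f {v, w} = insert z Y := by
      rw [hz]
      ext x; simp only [Finset.mem_symmDiff, Finset.mem_singleton, Finset.mem_insert]; grind
    have hinsL : insert z Y ∈ L := hins ▸ φ.f_mem hw
    obtain ⟨y, hy⟩ := nonempty_of_mem hYL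
    have hzy : z ≠ y := by rintro rfl; exact hzY hy
    set T := insert z (Y.erase y) with hT
    have hTL : T ∈ L := mem_of_subset hinsL
      (Finset.insert_subset_insert _ (Finset.erase_subset _ _)) (by simp [hT])
    have hcardT : T.card = Y.card := by
      rw [hT, Finset.card_insert_of_notMem (by simp [hzY]), Finset.card_erase_add_one hy]
    have hYy : Y.erase y ∈ L := by
      rw [← Finset.sdiff_singleton_eq_erase]
      exact hYA _ (by simpa using hy) (hne1 y)
    have hgYy : φ.g (Y.erase y) = {v, c y} := by
      rw [← Finset.sdiff_singleton_eq_erase, hfaces _ (by simpa using hy) (hne1 y),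
        Finset.image_singleton, Finset.insert_eq]
    have hvy : v ≠ c y := by
      rintro h; exact hvE (h ▸ Finset.mem_image_of_mem c hy)
    have hwy : w ≠ c y := by
      intro h
      have h1 : φ.f {v, c y} = Y.erase y := by rw [← hgYy, φ.f_g hYy]
      rw [← h, hins] at h1
      have := congrArg Finset.card h1
      rw [Finset.card_insert_of_notMem hzY, Finset.card_erase_of_mem hy] at this
      omega
    have a1 : HasseAdj (φ.g T) {v, w} := by
      have := φ.g_adj hTL hinsL (Or.inl ⟨Finset.insert_subset_insert _ (Finset.erase_subset _ _),
        by rw [hcardT, Finset.card_insert_of_notMem hzY]⟩)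
      rwa [← hins, φ.g_f hw] at this
    have a2 : HasseAdj (φ.g T) {v, c y} := by
      have := φ.g_adj hTL hYy (Or.inr ⟨Finset.subset_insert _ _, by
        rw [hcardT, Finset.card_erase_add_one hy]⟩)
      rwa [hgYy] at this
    have hTv : φ.g T ≠ {v} := by
      intro h
      have : T = Y := by rw [← φ.f_g hTL, h]
      have hz : z ∈ T := by simp [hT]
      exact hzY (this ▸ hz)
    have hK1 := φ.g_mem hTL
    have hTK := nonempty_of_mem hK1
    have hS : {v, w} ⊆ φ.g T ∧ {v, c y} ⊆ φ.g T ∧ (φ.g T).card = 3 := by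
      rcases a1 with ⟨h1, h2⟩ | ⟨h1, h2⟩
      · exfalso
        rw [Finset.card_pair hwv.symm] at h2
        obtain ⟨u, hu⟩ := Finset.card_eq_one.1 (show (φ.g T).card = 1 by omega)
        rw [hu] at h1 a2 hTv
        have h3 : u = w := by
          have : u = v ∨ u = w := by simpa using h1
          rcases this with rfl | h
          · exact absurd rfl hTv
          · exact h
        subst h3
        rcases a2 with ⟨h4, h5⟩ | ⟨h4, h5⟩
        · have : u = v ∨ u = c y := by simpa using h4
          grind
        · rw [Finset.card_pair hvy, Finset.card_singleton] at h5
          omega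
      · rw [Finset.card_pair hwv.symm] at h2
        rcases a2 with ⟨h4, h5⟩ | ⟨h4, h5⟩
        · rw [Finset.card_pair hvy] at h5
          omega
        · exact ⟨h1, h4, h2⟩
    obtain ⟨d, hd, hP | hR⟩ := φ.preserves_or_reverses hK1 hS.2.2.ge
    · have h1 := hP.card_f hd hS.1 (by simp)
      have h2 := hP.card_f hd subset_rfl hTK
      rw [hins, Finset.card_insert_of_notMem hzY, Finset.card_pair hwv.symm] at h1
      omega
    · have h1 := hR.card_f hd hS.2.1 (by simp)
      rw [← hgYy, φ.f_g hYy, φ.f_g hTL, hgYy, hcardT, Finset.card_erase_of_mem hy,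
        Finset.card_pair hvy] at h1
      omega
  refine ⟨Y.image c, hvE, Finset.card_image_of_injOn hc, fun s hvs => ⟨fun hs => ?_, fun hs => ?_⟩⟩
  · refine Finset.ssubset_iff_subset_ne.2 ⟨fun w hw => ?_, ?_⟩
    · by_cases hwv : w = v
      · simp [hwv]
      · refine Finset.mem_insert_of_mem (hedge w hwv (mem_of_subset hs ?_ (by simp)))
        simp [Finset.insert_subset_iff, hvs, hw]
    · rintro rfl
      exact hnot (by rwa [← Finset.insert_eq])
  · have hA : ∃ A ⊆ Y, A ≠ Y ∧ s = {v} ∪ A.image c := by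
      refine ⟨Y.filter (fun y => c y ∈ s), Finset.filter_subset _ _, fun h => ?_, ?_⟩
      · refine hs.2 (Finset.insert_subset hvs fun x hx => ?_)
        obtain ⟨y, hy, rfl⟩ := Finset.mem_image.1 hx
        rw [← h] at hy
        exact (Finset.mem_filter.1 hy).2
      · ext x
        simp only [Finset.mem_union, Finset.mem_singleton, Finset.mem_image, Finset.mem_filter]
        constructor
        · intro hx
          have := hs.1 hx
          simp only [Finset.mem_insert, Finset.mem_image] at this
          grind
        · grind
    obtain ⟨A, hAY, hne, rfl⟩ := hA
    rw [← hfaces A hAY hne]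
    exact φ.g_mem (hYA A hAY hne)

/-- If a vertex corresponds to a simplex of dimension at least two, then so do its neighbours, with
the same star up to the choice of the centre; by connectedness the complex is the boundary of a
simplex. -/
theorem isomorphic_simplexBoundary_of_three_le (φ : HasseIso K L) (hK : K.IsConnected) {v : α}
    (hv : {v} ∈ K) (h3 : 3 ≤ (φ.f {v}).card) : ∃ n, K.Isomorphic (simplexBoundary n) := by
  obtain ⟨E, hvE, hE, hstar⟩ := φ.exists_star hv h3
  set V := insert v E with hV
  have hVcard : V.card = E.card + 1 := Finset.card_insert_of_notMem hvE
  have hsub : ∀ s ⊆ V, v ∈ s → s.card ≤ 3 → s ∈ K := by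
    intro s hs hvs hsc
    rw [hstar s hvs]
    refine Finset.ssubset_iff_subset_ne.2 ⟨hs, ?_⟩
    rintro rfl
    omega
  have hall : ∀ w ∈ V, ∀ s, w ∈ s → (s ∈ K ↔ s ⊂ V) := by
    intro w hw
    by_cases hwv : w = v
    · subst hwv; exact hstar
    have hwE : w ∈ E := by
      rw [hV, Finset.mem_insert] at hw
      exact hw.resolve_left hwv
    obtain ⟨u, huE, huw⟩ : ∃ u ∈ E, u ≠ w := Finset.exists_mem_ne (by omega) w
    have huv : u ≠ v := by rintro rfl; exact hvE huE
    have hScard : ({v, w, u} : Finset α).card = 3 := Finset.card_eq_three.2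
      ⟨v, w, u, Ne.symm hwv, huv.symm, huw.symm, rfl⟩
    have hS : {v, w, u} ∈ K := by
      refine hsub _ ?_ (by simp) hScard.le
      simp [Finset.insert_subset_iff, hV, hwE, huE]
    have hfw : (φ.f {w}).card = (φ.f {v}).card := by
      obtain ⟨c, hc, hP | hR⟩ := φ.preserves_or_reverses hS hScard.ge
      · have := hP.card_f hc (s := {v}) (by simp) (by simp)
        rw [Finset.card_singleton] at this
        omega
      · have h1 := hR.card_f hc (s := {v}) (by simp) (by simp)
        have h2 := hR.card_f hc (s := {w}) (by simp) (by simp)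
        simp only [Finset.card_singleton] at h1 h2
        omega
    obtain ⟨E', hwE', hE', hstar'⟩ := φ.exists_star (singleton_mem hS (a := w) (by simp))
      (hfw ▸ h3)
    have hVE' : V = insert w E' := by
      refine Finset.eq_of_subset_of_card_le (fun x hx => ?_) ?_
      · have h1 : {v, w, x} ∈ K := by
          refine hsub _ ?_ (by simp) Finset.card_le_three
          intro y hy
          simp only [Finset.mem_insert, Finset.mem_singleton] at hy
          rcases hy with rfl | rfl | rfl
          exacts [Finset.mem_insert_self _ _, hw, hx]
        exact ((hstar' _ (by simp)).1 h1).1 (by simp)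
      · rw [Finset.card_insert_of_notMem hwE', hVcard]
        omega
    rwa [hVE']
  have hvert : ∀ w, {w} ∈ K → w ∈ V := by
    intro w hw
    refine hK.induction (P := fun x => x ∈ V) (fun x y _ hxy hx => ?_) hv hw
      (Finset.mem_insert_self v E)
    exact ((hall x hx _ (by simp)).1 hxy).1 (by simp)
  refine ⟨E.card, isomorphic_simplexBoundary hVcard (by omega) fun s => ⟨fun hs => ?_, ?_⟩⟩
  · obtain ⟨w, hw⟩ := nonempty_of_mem hs
    exact ⟨⟨w, hw⟩, (hall w (hvert w (singleton_mem hs hw)) s hw).1 hs⟩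
  · rintro ⟨⟨w, hw⟩, hs⟩
    exact (hall w (hs.1 hw) s hw).2 hs

end HasseIso

/-! ### Connected graphs of degree two -/

/-- A finite connected graph in which all vertices have degree two is a cycle. -/
theorem exists_zmod_equiv_of_regular_two {X : Type*} [Finite X] (G : SimpleGraph X)
    (hG : G.Connected) (hreg : ∀ v, ∃ a b, a ≠ b ∧ ∀ w, G.Adj v w ↔ w = a ∨ w = b) :
    ∃ n, 3 ≤ n ∧ ∃ e : ZMod n ≃ X, ∀ i j, G.Adj (e i) (e j) ↔ j = i + 1 ∨ i = j + 1 := by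
  have : ∀ v w, ∃ u, G.Adj w v → u ≠ v ∧ ∀ x, G.Adj w x ↔ x = v ∨ x = u := by
    intro v w
    obtain ⟨a, b, hab, h⟩ := hreg w
    by_cases hva : v = a
    · exact ⟨b, fun _ => ⟨fun hb => hab (by rw [hb, hva]), fun x => by rw [h, hva]⟩⟩
    · refine ⟨a, fun hv => ⟨Ne.symm hva, fun x => ?_⟩⟩
      rw [h, or_comm, ((h v).1 hv).resolve_left hva]
  choose o ho using this
  have ho1 : ∀ {v w}, G.Adj w v → G.Adj w (o v w) := fun h => ((ho _ _ h).2 _).2 (Or.inr rfl)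
  have ho2 : ∀ {v w}, G.Adj w v → o (o v w) w = v := by
    intro v w h
    have h1 := ho _ _ (ho1 h)
    have h2 := ho _ _ h
    exact ((h2.2 _).1 ((h1.2 _).2 (Or.inr rfl))).resolve_right h1.1
  -- Walking along the graph is a permutation `T` of the directed edges.
  let T : Equiv.Perm {p : X × X // G.Adj p.1 p.2} :=
    { toFun := fun p => ⟨(p.1.2, o p.1.1 p.1.2), ho1 p.2.symm⟩
      invFun := fun p => ⟨(o p.1.2 p.1.1, p.1.1), (ho1 p.2).symm⟩
      left_inv := fun p => Subtype.ext (Prod.ext (ho2 p.2.symm) rfl)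
      right_inv := fun p => Subtype.ext (Prod.ext rfl (ho2 p.2)) }
  obtain ⟨x₀⟩ := hG.nonempty
  obtain ⟨a₀, b₀, -, h₀⟩ := hreg x₀
  let d : {p : X × X // G.Adj p.1 p.2} := ⟨(x₀, a₀), (h₀ a₀).2 (Or.inl rfl)⟩
  let u : ℤ → X := fun i => ((T ^ i) d).1.1
  have hT : ∀ i : ℤ, (T ^ (i + 1)) d = T ((T ^ i) d) := fun i => by
    rw [add_comm, zpow_add, zpow_one, Equiv.Perm.mul_apply]
  have hsnd : ∀ i, ((T ^ i) d).1.2 = u (i + 1) := fun i => by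
    simp only [u]; rw [hT]; rfl
  have hadj : ∀ i, G.Adj (u i) (u (i + 1)) := fun i => hsnd i ▸ ((T ^ i) d).2
  have hu2 : ∀ i, u (i + 1 + 1) = o (u i) (u (i + 1)) := fun i => by
    rw [← hsnd (i + 1), hT, ← hsnd i]; rfl
  have hnb : ∀ i x, G.Adj (u (i + 1)) x ↔ x = u i ∨ x = u (i + 1 + 1) := fun i x => by
    rw [hu2]; exact (ho _ _ (hadj i).symm).2 x
  have hne : ∀ i, u (i + 1 + 1) ≠ u i := fun i => by
    rw [hu2]; exact (ho _ _ (hadj i).symm).1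
  -- The walk cannot come back to a vertex in the opposite direction: it would have to turn.
  have hback : ∀ i j, j ≤ i → u i = u j → (T ^ i) d = (T ^ j) d := by
    intro i j hji hij
    refine Subtype.ext (Prod.ext hij ?_)
    rw [hsnd, hsnd]
    have h1 := hadj j
    rw [← hij, ← sub_add_cancel i 1, hnb] at h1
    rcases h1 with h1 | h1
    · exfalso
      have key : ∀ k : ℕ, u (j + k) = u (i - k) ∧ u (j + k + 1) = u (i - k - 1) := by
        intro k
        induction k with
        | zero => exact ⟨by simpa using hij.symm, by simpa using h1⟩
        | succ k ih =>
          have e1 : j + ((k + 1 : ℕ) : ℤ) = j + k + 1 := by push_cast; ring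
          have e2 : i - ((k + 1 : ℕ) : ℤ) = i - k - 1 := by push_cast; ring
          rw [e1, e2]
          refine ⟨ih.2, ?_⟩
          have h2 := hadj (j + k + 1)
          have h3 := hnb (i - k - 1 - 1) (u (j + k + 1 + 1))
          simp only [sub_add_cancel] at h3
          rw [ih.2, h3] at h2
          refine h2.resolve_right fun h4 => hne (j + k) (h4.trans ih.1.symm)
      obtain ⟨m, hm | hm⟩ := Int.even_or_odd' (i - j)
      · rcases (show 0 ≤ m by omega).eq_or_lt with h0 | h0
        · obtain rfl : i = j := by omega
          have := hne (i - 1)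
          simp only [sub_add_cancel] at this
          exact this h1
        · have h2 := (key (m - 1).toNat).1
          rw [Int.toNat_of_nonneg (by omega)] at h2
          refine hne (j + (m - 1)) ?_
          rw [h2]
          congr 1
          omega
      · have h2 := (key m.toNat).1
        rw [Int.toNat_of_nonneg (by omega)] at h2
        refine (hadj (j + m)).ne (h2.trans ?_)
        congr 1
        omega
    · rw [h1]; simp
  set n := Function.minimalPeriod (T • ·) d with hn
  have hdvd : ∀ i j, u i = u j ↔ (n : ℤ) ∣ i - j := by
    intro i j
    rw [← MulAction.zpow_smul_eq_iff_minimalPeriod_dvd, sub_eq_neg_add, zpow_add, mul_smul,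
      zpow_neg, inv_smul_eq_iff]
    constructor
    · intro h
      rcases le_total j i with h1 | h1
      · exact hback i j h1 h
      · exact (hback j i h1 h.symm).symm
    · intro h
      exact congrArg (fun p => p.1.1) h
  have hn0 : n ≠ 0 := by
    have := Function.Injective.mem_periodicPts (f := (T • ·)) (MulAction.injective T) d
    exact (Function.minimalPeriod_pos_of_mem_periodicPts this).ne'
  have hn1 : n ≠ 1 := fun h => (hadj 0).ne ((hdvd _ _).2 (by simp [h]))
  have hn2 : n ≠ 2 := fun h => hne 0 ((hdvd _ _).2 (by simp [h]))
  have hsurj : ∀ x, ∃ i, u i = x := by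
    intro x
    obtain ⟨p⟩ := hG.preconnected (u 0) x
    suffices ∀ x y, G.Walk x y → (∃ i, u i = x) → ∃ i, u i = y from this _ _ p ⟨0, rfl⟩
    intro x y q
    induction q with
    | nil => exact id
    | cons h _ ih =>
      rintro ⟨i, rfl⟩
      rw [← sub_add_cancel i 1, hnb] at h
      rcases h with h | h
      · exact ih ⟨_, h.symm⟩
      · exact ih ⟨_, h.symm⟩
  have hcast : ∀ i : ℤ, u ((i : ZMod n).cast : ℤ) = u i := by
    intro i
    rw [hdvd, ← ZMod.intCast_zmod_eq_zero_iff_dvd]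
    simp
  have hbij : Function.Bijective (fun z : ZMod n => u (z.cast : ℤ)) := by
    constructor
    · intro z w h
      have := (hdvd _ _).1 h
      rw [← ZMod.intCast_zmod_eq_zero_iff_dvd] at this
      simpa [sub_eq_zero] using this
    · intro x
      obtain ⟨i, rfl⟩ := hsurj x
      exact ⟨i, hcast i⟩
  refine ⟨n, by omega, Equiv.ofBijective _ hbij, fun z w => ?_⟩
  obtain ⟨i, rfl⟩ := ZMod.intCast_surjective z
  obtain ⟨j, rfl⟩ := ZMod.intCast_surjective w
  simp only [Equiv.ofBijective_apply, hcast]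
  have hz : ∀ a b : ℤ, (a : ZMod n) = b ↔ u a = u b := fun a b => by
    rw [hdvd, ← ZMod.intCast_zmod_eq_zero_iff_dvd]
    push_cast
    rw [sub_eq_zero]
  have h1 : (j : ZMod n) = i + 1 ↔ u j = u (i + 1) := by rw [← hz]; push_cast; rfl
  have h2 : (i : ZMod n) = j + 1 ↔ u j = u (i - 1) := by
    rw [← hz]; push_cast; rw [eq_comm, eq_sub_iff_add_eq]
  rw [h1, h2]
  have h3 := hnb (i - 1) (u j)
  simp only [sub_add_cancel] at h3
  rw [h3, or_comm]

/-- A one-dimensional complex whose vertices have degree two is a cycle. -/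
lemma isomorphic_cycle {α : Type*} [DecidableEq α] {K : PreAbstractSimplicialComplex α}
    (hfin : K.faces.Finite) (hK : K.IsConnected) (hdim : ∀ s ∈ K, s.card ≤ 2)
    (hreg : ∀ v, {v} ∈ K → ∃ a b, a ≠ b ∧ ∀ w, (v ≠ w ∧ {v, w} ∈ K) ↔ w = a ∨ w = b) :
    ∃ n, 3 ≤ n ∧ K.Isomorphic (cycle n) := by
  have : Finite K.vertices :=
    (hfin.preimage (Finset.singleton_injective.injOn) : (K.vertices).Finite).to_subtype
  have hadj : ∀ v w : K.vertices, K.oneSkeleton.Adj v w ↔ (v : α) ≠ w ∧ {(v : α), (w : α)} ∈ K := by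
    intro v w
    refine and_congr Subtype.coe_ne_coe.symm ⟨?_, fun h => ⟨_, h, by simp, by simp⟩⟩
    rintro ⟨s, hs, h1, h2⟩
    exact mem_of_subset hs (by simp [Finset.insert_subset_iff, h1, h2]) (by simp)
  obtain ⟨n, hn, e, he⟩ := exists_zmod_equiv_of_regular_two K.oneSkeleton hK (by
    intro v
    obtain ⟨a, b, hab, h⟩ := hreg v v.2
    have ha : {a} ∈ K := singleton_mem ((h a).2 (Or.inl rfl)).2 (by simp)
    have hb : {b} ∈ K := singleton_mem ((h b).2 (Or.inr rfl)).2 (by simp)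
    refine ⟨⟨a, ha⟩, ⟨b, hb⟩, fun h => hab (congrArg Subtype.val h), fun w => ?_⟩
    rw [hadj, h]
    simp [Subtype.ext_iff])
  have hvert : ∀ i : ZMod n, i ∈ (cycle n).vertices := fun i =>
    ⟨by simp, i, by simp⟩
  refine ⟨n, hn, e.symm.trans (Equiv.subtypeUnivEquiv hvert).symm, fun s => ?_⟩
  have h1 : (s.map (e.symm.trans (Equiv.subtypeUnivEquiv hvert).symm).toEmbedding).map
      (Function.Embedding.subtype _) = s.map e.symm.toEmbedding := by
    rw [Finset.map_map]; rfl
  rw [h1]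
  change (Finset.Nonempty _ ∧ _) ↔ _
  rw [Finset.map_nonempty]
  constructor
  · rintro ⟨hne, i, hi⟩
    have h2 := ((hadj _ _).1 ((he i (i + 1)).2 (Or.inl rfl))).2
    refine mem_of_subset h2 (fun x hx => ?_) (Finset.map_nonempty.2 hne)
    obtain ⟨y, hy, rfl⟩ := Finset.mem_map.1 hx
    have h3 := hi (Finset.mem_map_of_mem _ hy)
    simp only [Equiv.coe_toEmbedding, Finset.mem_insert, Finset.mem_singleton,
      Equiv.symm_apply_eq] at h3
    rcases h3 with rfl | rfl <;> simp
  · intro hs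
    have hne := Finset.map_nonempty.1 (nonempty_of_mem hs)
    refine ⟨hne, ?_⟩
    have hc := hdim _ hs
    rw [Finset.card_map] at hc
    rcases hc.lt_or_eq with hc | hc
    · obtain ⟨v, rfl⟩ := Finset.card_eq_one.1 (show s.card = 1 by have := hne.card_pos; omega)
      exact ⟨e.symm v, by simp⟩
    · obtain ⟨v, w, hvw, rfl⟩ := Finset.card_eq_two.1 hc
      have h2 : K.oneSkeleton.Adj v w := ⟨hvw, _, hs, by simp, by simp⟩
      have h3 := he (e.symm v) (e.symm w)
      simp only [Equiv.apply_symm_apply] at h3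
      rcases h3.1 h2 with h | h
      · exact ⟨e.symm v, by simp [h]⟩
      · exact ⟨e.symm w, by simp [Finset.insert_subset_iff, h]⟩

/-! ### Isomorphisms of Hasse diagrams preserve dimensions -/

lemma exists_eq_pair_of_hasseAdj {α : Type*} [DecidableEq α] {K : PreAbstractSimplicialComplex α}
    {v : α} {s : Finset α} (hs : s ∈ K) (h : HasseAdj {v} s) : ∃ w, v ≠ w ∧ s = {v, w} := by
  rcases h with ⟨h1, h2⟩ | ⟨h1, h2⟩
  · obtain ⟨a, b, hab, rfl⟩ := Finset.card_eq_two.1 (by simpa using h2)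
    have : v = a ∨ v = b := by simpa using h1
    rcases this with rfl | rfl
    · exact ⟨b, hab, rfl⟩
    · exact ⟨a, hab.symm, Finset.pair_comm _ _⟩
  · have := (nonempty_of_mem hs).card_pos
    rw [Finset.card_singleton] at h2
    omega

lemma covers_singleton_pair {α : Type*} [DecidableEq α] {v w : α} (h : v ≠ w) :
    Covers {v} {v, w} :=
  ⟨by simp, by rw [Finset.card_pair h, Finset.card_singleton]⟩

namespace HasseIso

variable {α β : Type*} [DecidableEq α] [DecidableEq β]
  {K : PreAbstractSimplicialComplex α} {L : PreAbstractSimplicialComplex β}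

/-- Reversal among the faces of a simplex would map its vertices to simplices of dimension at least
two. -/
lemma exists_preserves (φ : HasseIso K L) (hle : ∀ v, {v} ∈ K → (φ.f {v}).card ≤ 2)
    {τ : Finset α} (hτ : τ ∈ K) (h3 : 3 ≤ τ.card) :
    ∃ c, Set.InjOn c τ ∧ φ.Preserves τ c := by
  obtain ⟨c, hc, hP | hR⟩ := φ.preserves_or_reverses hτ h3
  · exact ⟨c, hc, hP⟩
  · obtain ⟨v, hv⟩ := nonempty_of_mem hτ
    have h1 := hR.card_f hc (s := {v}) (by simpa using hv) (by simp)
    have h2 := hle v (singleton_mem hτ hv)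
    have h4 := (nonempty_of_mem (φ.f_mem hτ)).card_pos
    rw [Finset.card_singleton] at h1
    omega

/-- If the inclusions among the faces of `T` were reversed, then the proper faces `s` of `T` would
satisfy `|g s| = |s|`, as nothing is reversed in `K`, while `|g s| + |s|` is constant. -/
lemma card_g_of_three_le (φ : HasseIso K L) (hle : ∀ v, {v} ∈ K → (φ.f {v}).card ≤ 2)
    {T : Finset β} (hT : T ∈ L) (h3 : 3 ≤ T.card) : (φ.g T).card = T.card := by
  obtain ⟨c, hc, hP | hR⟩ := φ.symm.preserves_or_reverses hT h3
  · exact hP.card_f hc subset_rfl (nonempty_of_mem hT)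
  exfalso
  have hgT := φ.g_mem hT
  have h1 : (φ.g T).card ≠ 1 := by
    intro h
    obtain ⟨v, hv⟩ := Finset.card_eq_one.1 h
    have h4 := hle v (hv ▸ hgT)
    rw [← hv, φ.f_g hT] at h4
    omega
  have h1' := (nonempty_of_mem hgT).card_pos
  have key : ∀ s ⊆ T, s.Nonempty → s ≠ T → s.card = (φ.g s).card ∧
      (φ.g s).card + s.card = (φ.g T).card + T.card := by
    intro s hs hne hsT
    have hsL := mem_of_subset hT hs hne
    have h5 : (φ.g s).card + s.card = (φ.g T).card + T.card := hR.card_f hc hs hne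
    have h6 := Finset.card_lt_card (Finset.ssubset_iff_subset_ne.2 ⟨hs, hsT⟩)
    have h7 : 3 ≤ (φ.g s).card := by omega
    obtain ⟨d, hd, hP⟩ := φ.exists_preserves hle (φ.g_mem hsL) h7
    have h8 := hP.card_f hd subset_rfl (nonempty_of_mem (φ.g_mem hsL))
    rw [φ.f_g hsL] at h8
    exact ⟨h8, h5⟩
  obtain ⟨s, hs, hsc⟩ := Finset.exists_subset_card_eq (show 1 ≤ T.card by omega)
  obtain ⟨t, ht, htc⟩ := Finset.exists_subset_card_eq (show 2 ≤ T.card by omega)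
  have h5 := key s hs (Finset.card_pos.1 (by omega)) (by rintro rfl; omega)
  have h6 := key t ht (Finset.card_pos.1 (by omega)) (by rintro rfl; omega)
  omega

/-- If some vertex corresponds to an edge, then by connectedness `φ` exchanges vertices and
edges, there are no triangles, and each vertex has two neighbours because an edge has two ends. -/
theorem isomorphic_cycle_of_card_eq_two (φ : HasseIso K L) (hfin : K.faces.Finite)
    (hK : K.IsConnected) (hle : ∀ v, {v} ∈ K → (φ.f {v}).card ≤ 2) {v : α} (hv : {v} ∈ K)
    (h2 : (φ.f {v}).card = 2) : ∃ n, 3 ≤ n ∧ K.Isomorphic (cycle n) := by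
  have hedge : ∀ x y, x ≠ y → {x, y} ∈ K → (φ.f {x}).card = 2 → (φ.f {x, y}).card = 1 := by
    intro x y hxy hK1 hx
    have h3 : (φ.f {x, y}).card ≤ 2 := by
      by_contra h
      have := φ.card_g_of_three_le hle (φ.f_mem hK1) (by omega)
      rw [φ.g_f hK1, Finset.card_pair hxy] at this
      omega
    have h4 := φ.f_adj (singleton_mem hK1 (a := x) (by simp)) hK1
      (Or.inl (covers_singleton_pair hxy))
    rcases h4 with ⟨-, h5⟩ | ⟨-, h5⟩ <;> omega
  have hall : ∀ w, {w} ∈ K → (φ.f {w}).card = 2 := by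
    intro w hw
    refine hK.induction (P := fun x => (φ.f {x}).card = 2) (fun x y hxy hK1 hx => ?_) hv hw h2
    have h3 := hedge x y hxy hK1 hx
    have hy := singleton_mem hK1 (a := y) (by simp)
    have h4 := φ.f_adj hy hK1 (Or.inl (Finset.pair_comm x y ▸ covers_singleton_pair hxy.symm))
    have h5 := (nonempty_of_mem (φ.f_mem hy)).card_pos
    rcases h4 with ⟨-, h5⟩ | ⟨-, h5⟩ <;> omega
  refine isomorphic_cycle hfin hK (fun s hs => ?_) fun w hw => ?_
  · by_contra h
    obtain ⟨c, hc, hP⟩ := φ.exists_preserves hle hs (by omega)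
    obtain ⟨x, hx⟩ := nonempty_of_mem hs
    have h1 := hP.card_f hc (s := {x}) (by simpa using hx) (by simp)
    rw [hall x (singleton_mem hs hx)] at h1
    simp at h1
  · obtain ⟨x, y, hxy, hfw⟩ := Finset.card_eq_two.1 (hall w hw)
    have hwL := φ.f_mem hw
    rw [hfw] at hwL
    have hxL := singleton_mem hwL (a := x) (by simp)
    have hyL := singleton_mem hwL (a := y) (by simp)
    have hgw : φ.g {x, y} = {w} := by rw [← hfw, φ.g_f hw]
    have hx := φ.g_adj hwL hxL (Or.inr (covers_singleton_pair hxy))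
    have hy := φ.g_adj hwL hyL (Or.inr (Finset.pair_comm x y ▸ covers_singleton_pair hxy.symm))
    rw [hgw] at hx hy
    obtain ⟨a, hwa, ha⟩ := exists_eq_pair_of_hasseAdj (φ.g_mem hxL) hx
    obtain ⟨b, hwb, hb⟩ := exists_eq_pair_of_hasseAdj (φ.g_mem hyL) hy
    refine ⟨a, b, ?_, fun z => ⟨?_, ?_⟩⟩
    · rintro rfl
      exact hxy (Finset.singleton_injective (φ.symm.f_inj hxL hyL (ha.trans hb.symm)))
    · rintro ⟨hwz, hz⟩
      obtain ⟨q, hq⟩ := Finset.card_eq_one.1 (hedge w z hwz hz (hall w hw))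
      have h3 := φ.f_adj hw hz (Or.inl (covers_singleton_pair hwz))
      rw [hq, hfw] at h3
      have hgq : φ.g {q} = {w, z} := by rw [← hq, φ.g_f hz]
      have hqxy : q = x ∨ q = y := by
        rcases h3 with ⟨-, h4⟩ | ⟨h4, -⟩
        · rw [Finset.card_singleton, Finset.card_pair hxy] at h4
          omega
        · simpa using h4
      have hpair : ∀ r, w ≠ r → ({w, z} : Finset α) = {w, r} → z = r := by
        intro r _ h
        have h5 : z ∈ ({w, r} : Finset α) := by rw [← h]; simp
        simp only [Finset.mem_insert, Finset.mem_singleton] at h5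
        exact h5.resolve_left hwz.symm
      rcases hqxy with rfl | rfl
      · exact Or.inl (hpair a hwa (hgq.symm.trans ha))
      · exact Or.inr (hpair b hwb (hgq.symm.trans hb))
    · rintro (rfl | rfl)
      · exact ⟨hwa, ha ▸ φ.g_mem hxL⟩
      · exact ⟨hwb, hb ▸ φ.g_mem hyL⟩

/-- Outside the two exceptional families, an isomorphism of Hasse diagrams preserves dimensions. -/
theorem card_f (φ : HasseIso K L) (hfin : K.faces.Finite) (hK : K.IsConnected)
    (hbd : ∀ n : ℕ, ¬ K.Isomorphic (simplexBoundary n))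
    (hcyc : ∀ n : ℕ, 3 ≤ n → ¬ K.Isomorphic (cycle n)) {s : Finset α} (hs : s ∈ K) :
    (φ.f s).card = s.card := by
  have hle : ∀ v, {v} ∈ K → (φ.f {v}).card ≤ 2 := by
    intro v hv
    by_contra h
    obtain ⟨n, hn⟩ := φ.isomorphic_simplexBoundary_of_three_le hK hv (by omega)
    exact hbd n hn
  have hone : ∀ v, {v} ∈ K → (φ.f {v}).card = 1 := by
    intro v hv
    have h1 := hle v hv
    have h2 := (nonempty_of_mem (φ.f_mem hv)).card_pos
    by_contra h
    obtain ⟨n, hn, hiso⟩ := φ.isomorphic_cycle_of_card_eq_two hfin hK hle hv (by omega)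
    exact hcyc n hn hiso
  have hpos := (nonempty_of_mem hs).card_pos
  rcases (show s.card = 1 ∨ s.card = 2 ∨ 3 ≤ s.card by omega) with h | h | h
  · obtain ⟨v, rfl⟩ := Finset.card_eq_one.1 h
    rw [hone v hs, h]
  · obtain ⟨v, w, hvw, rfl⟩ := Finset.card_eq_two.1 h
    have hv := singleton_mem hs (a := v) (by simp)
    have h1 := φ.f_adj hv hs (Or.inl (covers_singleton_pair hvw))
    have h2 := (nonempty_of_mem (φ.f_mem hs)).card_pos
    have h3 := hone v hv
    rcases h1 with ⟨-, h4⟩ | ⟨-, h4⟩ <;> omega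
  · obtain ⟨c, hc, hP⟩ := φ.exists_preserves hle hs h
    exact hP.card_f hc subset_rfl (nonempty_of_mem hs)

end HasseIso

/-! ### From regular pairs to vertices -/

namespace HasseIso

variable {α β : Type*} [DecidableEq α]
  {K : PreAbstractSimplicialComplex α} {L : PreAbstractSimplicialComplex β}

lemma covers_f_erase (φ : HasseIso K L) (hcard : ∀ s ∈ K, (φ.f s).card = s.card) {s : Finset α}
    (hs : s ∈ K) (h2 : 2 ≤ s.card) {a : α} (ha : a ∈ s) : Covers (φ.f (s.erase a)) (φ.f s) := by
  have h1 := Finset.card_erase_add_one ha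
  have hm : s.erase a ∈ K := mem_of_subset hs (Finset.erase_subset _ _)
    (Finset.card_pos.1 (by omega))
  rcases φ.f_adj hm hs (Or.inl ⟨Finset.erase_subset _ _, h1.symm⟩) with h | ⟨-, h⟩
  · exact h
  · rw [hcard _ hs, hcard _ hm] at h
    omega

variable [DecidableEq β]

/-- A dimension preserving isomorphism of Hasse diagrams is induced by its action on vertices. -/
lemma mem_f_iff (φ : HasseIso K L) (hcard : ∀ s ∈ K, (φ.f s).card = s.card) {s : Finset α}
    (hs : s ∈ K) (b : β) : b ∈ φ.f s ↔ ∃ a ∈ s, φ.f {a} = {b} := by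
  induction hn : s.card using Nat.strong_induction_on generalizing s with
  | _ n ih =>
    have hpos := (nonempty_of_mem hs).card_pos
    rcases (show s.card = 1 ∨ 2 ≤ s.card by omega) with h | h
    · obtain ⟨v, rfl⟩ := Finset.card_eq_one.1 h
      obtain ⟨w, hw⟩ := Finset.card_eq_one.1 ((hcard _ hs).trans h)
      simp [hw, eq_comm]
    have hm : ∀ a ∈ s, s.erase a ∈ K := fun a ha => mem_of_subset hs (Finset.erase_subset _ _)
      (Finset.card_pos.1 (by have := Finset.card_erase_add_one ha; omega))
    have hih : ∀ a ∈ s, (b ∈ φ.f (s.erase a) ↔ ∃ x ∈ s.erase a, φ.f {x} = {b}) := fun a ha =>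
      ih _ (by have := Finset.card_erase_add_one ha; omega) (hm a ha) rfl
    constructor
    · intro hb
      obtain ⟨x, hx, y, hy, hxy⟩ := Finset.one_lt_card.1 h
      by_cases hbx : b ∈ φ.f (s.erase x)
      · obtain ⟨a, ha, hab⟩ := (hih x hx).1 hbx
        exact ⟨a, Finset.mem_of_mem_erase ha, hab⟩
      by_cases hby : b ∈ φ.f (s.erase y)
      · obtain ⟨a, ha, hab⟩ := (hih y hy).1 hby
        exact ⟨a, Finset.mem_of_mem_erase ha, hab⟩
      exfalso
      have key : ∀ a ∈ s, b ∉ φ.f (s.erase a) → φ.f (s.erase a) = φ.f s ∆ {b} := by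
        intro a ha hba
        obtain ⟨z, hz⟩ := hasseAdj_iff.1 (Or.inr (φ.covers_f_erase hcard hs h ha))
        have : b = z := by
          rw [hz] at hba
          simp only [Finset.mem_symmDiff, Finset.mem_singleton] at hba
          grind
        rw [hz, this]
      have h1 := φ.f_inj (hm x hx) (hm y hy) ((key x hx hbx).trans (key y hy hby).symm)
      have h2 : x ∈ s.erase y := Finset.mem_erase.2 ⟨hxy, hx⟩
      rw [← h1] at h2
      exact Finset.notMem_erase _ _ h2
    · rintro ⟨a, ha, hab⟩
      obtain ⟨x, hx, hxa⟩ := Finset.exists_mem_ne (s := s) (by omega) a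
      refine (φ.covers_f_erase hcard hs h hx).1 ((hih x hx).2 ⟨a, ?_, hab⟩)
      exact Finset.mem_erase.2 ⟨hxa.symm, ha⟩

/-- The bijection of vertices given by a dimension preserving isomorphism of Hasse diagrams is an
isomorphism of complexes. -/
theorem exists_isIsomorphism (φ : HasseIso K L) (hcard : ∀ s ∈ K, (φ.f s).card = s.card) :
    ∃ e : K.vertices ≃ L.vertices, IsIsomorphism e ∧
      ∀ s ∈ K, ∀ b, b ∈ φ.f s ↔ ∃ a : K.vertices, (a : α) ∈ s ∧ (e a : β) = b := by
  have hcard' : ∀ t ∈ L, (φ.g t).card = t.card := by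
    intro t ht
    rw [← hcard _ (φ.g_mem ht), φ.f_g ht]
  have hf : ∀ v : K.vertices, ∃ w, φ.f {(v : α)} = {w} := fun v =>
    Finset.card_eq_one.1 ((hcard _ v.2).trans (by simp))
  have hg : ∀ v : L.vertices, ∃ w, φ.g {(v : β)} = {w} := fun v =>
    Finset.card_eq_one.1 ((hcard' _ v.2).trans (by simp))
  choose p hp using hf
  choose q hq using hg
  have hpL : ∀ v, p v ∈ L.vertices := fun v => by
    change {p v} ∈ L
    rw [← hp]; exact φ.f_mem v.2
  have hqK : ∀ v, q v ∈ K.vertices := fun v => by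
    change {q v} ∈ K
    rw [← hq]; exact φ.g_mem v.2
  let e : K.vertices ≃ L.vertices :=
    { toFun := fun v => ⟨p v, hpL v⟩
      invFun := fun v => ⟨q v, hqK v⟩
      left_inv := fun v => by
        apply Subtype.ext
        have h := hq ⟨p v, hpL v⟩
        have hv : {(v : α)} ∈ K := v.2
        rw [← hp, φ.g_f hv] at h
        exact (Finset.singleton_injective h).symm
      right_inv := fun v => by
        apply Subtype.ext
        have h := hp ⟨q v, hqK v⟩
        have hv : {(v : β)} ∈ L := v.2
        rw [← hq, φ.f_g hv] at h
        exact (Finset.singleton_injective h).symm }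
  have hmem : ∀ s ∈ K, ∀ b, b ∈ φ.f s ↔ ∃ a : K.vertices, (a : α) ∈ s ∧ (e a : β) = b := by
    intro s hs b
    rw [φ.mem_f_iff hcard hs]
    constructor
    · rintro ⟨a, ha, hab⟩
      refine ⟨⟨a, singleton_mem hs ha⟩, ha, ?_⟩
      exact Finset.singleton_injective ((hp _).symm.trans hab)
    · rintro ⟨a, ha, rfl⟩
      exact ⟨a, ha, hp a⟩
  refine ⟨e, fun s => ⟨fun h => ?_, fun h => ?_⟩, hmem⟩
  · suffices s.map (Function.Embedding.subtype _) =
        φ.g ((s.map e.toEmbedding).map (Function.Embedding.subtype _)) by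
      rw [this]; exact φ.g_mem h
    ext a
    have h1 := φ.symm.mem_f_iff hcard' h a
    change a ∈ φ.g _ ↔ ∃ b ∈ _, φ.g {b} = {a} at h1
    rw [h1]
    simp only [Finset.mem_map, Function.Embedding.subtype_apply, Equiv.coe_toEmbedding]
    constructor
    · rintro ⟨v, hv, rfl⟩
      refine ⟨e v, ⟨e v, ⟨v, hv, rfl⟩, rfl⟩, ?_⟩
      rw [← φ.g_f (show {(v : α)} ∈ K from v.2), hp]
      rfl
    · rintro ⟨_, ⟨_, ⟨v, hv, rfl⟩, rfl⟩, h2⟩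
      refine ⟨v, hv, ?_⟩
      change φ.g {p v} = {a} at h2
      rw [← hp, φ.g_f (show {(v : α)} ∈ K from v.2)] at h2
      exact Finset.singleton_injective h2
  · suffices (s.map e.toEmbedding).map (Function.Embedding.subtype _) =
        φ.f (s.map (Function.Embedding.subtype _)) by
      rw [this]; exact φ.f_mem h
    ext b
    rw [hmem _ h]
    simp only [Finset.mem_map, Function.Embedding.subtype_apply, Equiv.coe_toEmbedding]
    constructor
    · rintro ⟨_, ⟨v, hv, rfl⟩, rfl⟩
      exact ⟨v, ⟨v, hv, rfl⟩, rfl⟩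
    · rintro ⟨v, ⟨w, hw, hwv⟩, rfl⟩
      exact ⟨e v, ⟨v, Subtype.ext hwv ▸ hw, rfl⟩, rfl⟩

end HasseIso

/-- A pair of simplices `(σ, τ)` with `σ` a codimension-one face of `τ`, that is, an edge of the
Hasse diagram, or a vertex of the Morse complex. -/
abbrev HassePair {α : Type*} (K : PreAbstractSimplicialComplex α) : Type _ :=
  {p : Finset α × Finset α // p.1 ∈ K ∧ p.2 ∈ K ∧ p.1 ⊆ p.2 ∧ p.2.card = p.1.card + 1}

/-- Two pairs of simplices have a simplex in common. -/
def Meets {α : Type*} (p q : Finset α × Finset α) : Prop :=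
  ∃ s, (s = p.1 ∨ s = p.2) ∧ (s = q.1 ∨ s = q.2)

/-- Two edges of a graded graph with two common ends are equal. -/
lemma eq_of_common_ends {X : Type*} (r : X → ℕ) {a b c d v w : X} (hp : r b = r a + 1)
    (hq : r d = r c + 1) (hne : v ≠ w) (h1 : v = a ∨ v = b) (h2 : w = a ∨ w = b)
    (h3 : v = c ∨ v = d) (h4 : w = c ∨ w = d) : a = c ∧ b = d := by
  grind

/-- Pairwise meeting edges of a graded graph have a common end. -/
lemma exists_common_end {X : Type*} (r : X → ℕ) {a b c d e f u v w : X} (hp : r b = r a + 1)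
    (hq : r d = r c + 1) (hr : r f = r e + 1) (h1 : u = a ∨ u = b) (h2 : u = c ∨ u = d)
    (h3 : v = a ∨ v = b) (h4 : v = e ∨ v = f) (h5 : w = c ∨ w = d) (h6 : w = e ∨ w = f) :
    (u = e ∨ u = f) ∨ (v = c ∨ v = d) ∨ (w = a ∨ w = b) := by
  grind

section Pairs

variable {α β : Type*}
  {K : PreAbstractSimplicialComplex α} {L : PreAbstractSimplicialComplex β}

lemma hasseAdj_iff_exists_pair {s t : K.faces} :
    HasseAdj s.1 t.1 ↔ s ≠ t ∧ ∃ p : HassePair K,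
      (s.1 = p.1.1 ∨ s.1 = p.1.2) ∧ (t.1 = p.1.1 ∨ t.1 = p.1.2) := by
  constructor
  · intro h
    refine ⟨fun h1 => h.ne (congrArg Subtype.val h1), ?_⟩
    rcases h with h | h
    · exact ⟨⟨(s.1, t.1), s.2, t.2, h⟩, Or.inl rfl, Or.inr rfl⟩
    · exact ⟨⟨(t.1, s.1), t.2, s.2, h⟩, Or.inr rfl, Or.inl rfl⟩
  · rintro ⟨hne, p, h1, h2⟩
    have hne' : s.1 ≠ t.1 := fun h => hne (Subtype.ext h)
    have hp : Covers p.1.1 p.1.2 := p.2.2.2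
    rcases h1 with h1 | h1 <;> rcases h2 with h2 | h2
    · exact absurd (h1.trans h2.symm) hne'
    · rw [h1, h2]; exact Or.inl hp
    · rw [h1, h2]; exact Or.inr hp
    · exact absurd (h1.trans h2.symm) hne'

lemma meets_iff_exists_face (p q : HassePair K) : Meets p.1 q.1 ↔
    ∃ s : K.faces, (s.1 = p.1.1 ∨ s.1 = p.1.2) ∧ (s.1 = q.1.1 ∨ s.1 = q.1.2) := by
  constructor
  · rintro ⟨s, h1, h2⟩
    have hs : s ∈ K := by
      rcases h1 with rfl | rfl
      exacts [p.2.1, p.2.2.1]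
    exact ⟨⟨s, hs⟩, h1, h2⟩
  · rintro ⟨s, h⟩
    exact ⟨s.1, h⟩

variable [DecidableEq α] [DecidableEq β]

lemma IsConnected.exists_edge (hK : K.IsConnected) (p : HassePair K) {v : α} (hv : {v} ∈ K) :
    ∃ w, v ≠ w ∧ {v, w} ∈ K := by
  by_contra! hnot
  obtain ⟨u, hu, huv⟩ : ∃ u ∈ p.1.2, u ≠ v := Finset.exists_mem_ne (by
    have := (nonempty_of_mem p.2.1).card_pos
    have := p.2.2.2.2
    omega) v
  refine huv (hK.induction (P := fun x => x = v) ?_ hv (singleton_mem p.2.2.1 hu) rfl)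
  rintro _ w hw h rfl
  exact absurd h (hnot w hw)

/-- Pairs as incidences between the pairs and the faces. The Hasse diagram is triangle-free since
it is bipartite, by the parity of dimensions. -/
lemma isTriangleFreeIncidence (hK : K.IsConnected) (p₀ : HassePair K) :
    IsTriangleFreeIncidence
      (fun (p : HassePair K) (s : K.faces) => s.1 = p.1.1 ∨ s.1 = p.1.2) where
  two_ends p := by
    refine ⟨⟨p.1.1, p.2.1⟩, ⟨p.1.2, p.2.2.1⟩, ?_, fun v => by simp [Subtype.ext_iff]⟩
    intro h
    have h1 := congrArg Finset.card (congrArg Subtype.val h)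
    have := p.2.2.2.2
    simp only at h1
    omega
  linear {p q v w} hne h1 h2 h3 h4 := by
    obtain ⟨h5, h6⟩ := eq_of_common_ends Finset.card p.2.2.2.2 q.2.2.2.2
      (fun h => hne (Subtype.ext h)) h1 h2 h3 h4
    exact Subtype.ext (Prod.ext h5 h6)
  triangle_free := by
    rintro p q r ⟨u, h1, h2⟩ ⟨v, h3, h4⟩ ⟨w, h5, h6⟩
    rcases exists_common_end Finset.card p.2.2.2.2 q.2.2.2.2 r.2.2.2.2 h1 h2 h3 h4 h5 h6
      with h | h | h
    exacts [⟨u, h1, h2, h⟩, ⟨v, h3, h, h4⟩, ⟨w, h, h5, h6⟩]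
  exists_edge := by
    rintro ⟨s, hs⟩
    have hs' : s ∈ K := hs
    have hpos := (nonempty_of_mem hs').card_pos
    rcases (show s.card = 1 ∨ 2 ≤ s.card by omega) with h | h
    · obtain ⟨v, rfl⟩ := Finset.card_eq_one.1 h
      obtain ⟨w, hvw, hw⟩ := hK.exists_edge p₀ hs'
      exact ⟨⟨({v}, {v, w}), hs', hw, covers_singleton_pair hvw⟩, Or.inl rfl⟩
    · obtain ⟨a, ha⟩ := nonempty_of_mem hs'
      have h1 := Finset.card_erase_add_one ha
      have h2 : 0 < (s.erase a).card := by omega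
      exact ⟨⟨(s.erase a, s), mem_of_subset hs' (Finset.erase_subset _ _)
        (Finset.card_pos.1 h2), hs', Finset.erase_subset _ _, h1.symm⟩, Or.inr rfl⟩
  exists_adj := by
    rintro ⟨⟨s, t⟩, hs, ht, hst, hc⟩
    obtain ⟨b, hb⟩ := nonempty_of_mem hs
    have hbt := hst hb
    have h1 : (t.erase b).card + 1 = t.card := Finset.card_erase_add_one hbt
    have h2 : 0 < s.card := (nonempty_of_mem hs).card_pos
    have h3 : 0 < (t.erase b).card := by
      change t.card = s.card + 1 at hc
      omega
    refine ⟨⟨(t.erase b, t), mem_of_subset ht (Finset.erase_subset _ _)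
        (Finset.card_pos.1 h3), ht, Finset.erase_subset _ _, h1.symm⟩, ?_, ⟨t, ht⟩, Or.inr rfl,
        Or.inr rfl⟩
    intro h
    have h4 : t.erase b = s := congrArg (fun p => p.1.1) h
    exact Finset.notMem_erase b t (h4.symm ▸ hb)

/-- A bijection of pairs that preserves and reflects the relation of having a common simplex is
induced by an isomorphism of Hasse diagrams. -/
lemma exists_hasseIso (hK : K.IsConnected) (hL : L.IsConnected) (p₀ : HassePair K)
    (F : HassePair K ≃ HassePair L)
    (hF : ∀ p q, Meets p.1 q.1 ↔ Meets (F p).1 (F q).1) :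
    ∃ φ : HasseIso K L, ∀ (p : HassePair K) (s : Finset α), s ∈ K →
      ((φ.f s = (F p).1.1 ∨ φ.f s = (F p).1.2) ↔ (s = p.1.1 ∨ s = p.1.2)) := by
  obtain ⟨φ, hφ⟩ := (isTriangleFreeIncidence hK p₀).exists_equiv
    (isTriangleFreeIncidence hL (F p₀)) F (fun p q => by
      rw [← meets_iff_exists_face, ← meets_iff_exists_face, hF])
  classical
  have hadj : ∀ s t : K.faces, HasseAdj s.1 t.1 ↔ HasseAdj (φ s).1 (φ t).1 := by
    intro s t
    rw [hasseAdj_iff_exists_pair, hasseAdj_iff_exists_pair, φ.injective.ne_iff]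
    refine and_congr_right fun _ => ?_
    rw [F.symm.exists_congr_left]
    simp only [Equiv.symm_symm]
    exact exists_congr fun p => and_congr (hφ p s).symm (hφ p t).symm
  refine ⟨⟨fun s => if h : s ∈ K then (φ ⟨s, h⟩).1 else ∅,
    fun t => if h : t ∈ L then (φ.symm ⟨t, h⟩).1 else ∅, fun {s} hs => ?_, fun {s} hs => ?_,
    fun {s} hs => ?_, fun {t} ht => ?_, fun {s t} hs ht h => ?_, fun {s t} hs ht h => ?_⟩, ?_⟩
  · rw [dif_pos hs]; exact (φ ⟨s, hs⟩).2
  · rw [dif_pos hs]; exact (φ.symm ⟨s, hs⟩).2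
  · have h1 : (φ ⟨s, hs⟩).1 ∈ L := (φ ⟨s, hs⟩).2
    rw [dif_pos hs, dif_pos h1]
    simp
  · have h1 : (φ.symm ⟨t, ht⟩).1 ∈ K := (φ.symm ⟨t, ht⟩).2
    rw [dif_pos ht, dif_pos h1]
    simp
  · rw [dif_pos hs, dif_pos ht]
    exact (hadj ⟨s, hs⟩ ⟨t, ht⟩).1 h
  · rw [dif_pos hs, dif_pos ht, hadj]
    simpa using h
  · intro p s hs
    simp only [dif_pos hs]
    exact hφ p ⟨s, hs⟩

/-- Outside the two exceptional families, a bijection of pairs that preserves and reflects the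
relation of having a common simplex is induced by an isomorphism of complexes. -/
theorem exists_isIsomorphism_of_meets_iff (hfin : K.faces.Finite) (hK : K.IsConnected)
    (hL : L.IsConnected) (hbd : ∀ n : ℕ, ¬ K.Isomorphic (simplexBoundary n))
    (hcyc : ∀ n : ℕ, 3 ≤ n → ¬ K.Isomorphic (cycle n)) (p₀ : HassePair K)
    (F : HassePair K ≃ HassePair L)
    (hF : ∀ p q, Meets p.1 q.1 ↔ Meets (F p).1 (F q).1) :
    ∃ e : K.vertices ≃ L.vertices, IsIsomorphism e ∧ ∀ (p : HassePair K) (b : β),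
      (b ∈ (F p).1.1 ↔ ∃ a : K.vertices, (a : α) ∈ p.1.1 ∧ (e a : β) = b) ∧
      (b ∈ (F p).1.2 ↔ ∃ a : K.vertices, (a : α) ∈ p.1.2 ∧ (e a : β) = b) := by
  obtain ⟨φ, hφ⟩ := exists_hasseIso hK hL p₀ F hF
  have hcard : ∀ s ∈ K, (φ.f s).card = s.card := fun s hs => φ.card_f hfin hK hbd hcyc hs
  obtain ⟨e, he, hmem⟩ := φ.exists_isIsomorphism hcard
  refine ⟨e, he, fun p b => ?_⟩
  have h1 := (hφ p _ p.2.1).2 (Or.inl rfl)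
  have h2 := (hφ p _ p.2.2.1).2 (Or.inr rfl)
  have h3 := hcard _ p.2.1
  have h4 := hcard _ p.2.2.1
  have h5 := p.2.2.2.2
  have h6 := (F p).2.2.2.2
  have h7 : φ.f p.1.1 = (F p).1.1 ∧ φ.f p.1.2 = (F p).1.2 := by
    rcases h1 with h1 | h1 <;> rcases h2 with h2 | h2 <;> rw [h1] at h3 <;> rw [h2] at h4
    · omega
    · exact ⟨h1, h2⟩
    · omega
    · omega
  rw [← h7.1, ← h7.2]
  exact ⟨hmem _ p.2.1 b, hmem _ p.2.2.1 b⟩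

end Pairs

/-! ### Vertices and edges of the Morse complex -/

section Morse

variable {γ : Type*} {K : PreAbstractSimplicialComplex γ}

lemma mem_vertices_morseComplex {p : Finset γ × Finset γ} :
    p ∈ K.morseComplex.vertices ↔
      p.1 ∈ K ∧ p.2 ∈ K ∧ p.1 ⊆ p.2 ∧ p.2.card = p.1.card + 1 := by
  constructor
  · rintro ⟨-, h⟩
    exact h.1.1 p (by simp)
  · intro h
    refine ⟨by simp, ⟨by simpa using h, by simp⟩, fun k a b hk hpath hclosed => ?_⟩
    obtain ⟨h1, -, -, h2⟩ := hpath 0 hk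
    rcases (show k = 1 ∨ 1 < k by omega) with rfl | hk'
    · exact h2 hclosed
    · have h3 := (hpath 1 hk').1
      simp only [Finset.mem_singleton] at h1 h3
      exact h2 (by rw [zero_add, show a 1 = p.1 from congrArg Prod.fst h3,
        show a 0 = p.1 from congrArg Prod.fst h1])

/-- Two pairs of simplices form a gradient vector field unless they have a common simplex: a closed
path through `(σ, τ)` and `(σ', τ')` would give `τ = σ ∪ σ' = τ'`. -/
lemma pair_mem_morseComplex_iff [DecidableEq γ] {p q : HassePair K} (hpq : p ≠ q) :
    {p.1, q.1} ∈ K.morseComplex ↔ ¬ Meets p.1 q.1 := by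
  have hne : p.1 ≠ q.1 := fun h => hpq (Subtype.ext h)
  have hself : ∀ r : HassePair K, r.1.1 ≠ r.1.2 := fun r h => by
    have := r.2.2.2.2
    rw [h] at this
    omega
  constructor
  · rintro ⟨-, h⟩ ⟨s, h1, h2⟩
    exact hne (h.1.2 _ (by simp) _ (by simp) s h1 h2)
  intro hm
  have hdisj : p.1.1 ≠ q.1.1 ∧ p.1.2 ≠ q.1.2 :=
    ⟨fun h => hm ⟨_, Or.inl rfl, Or.inl h⟩, fun h => hm ⟨_, Or.inr rfl, Or.inr h⟩⟩
  refine ⟨by simp, ⟨?_, ?_⟩, fun k a b hk hpath hclosed => ?_⟩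
  · simp only [Finset.mem_insert, Finset.mem_singleton]
    rintro r (rfl | rfl)
    exacts [p.2, q.2]
  · simp only [Finset.mem_insert, Finset.mem_singleton]
    rintro r (rfl | rfl) r' (rfl | rfl) s h1 h2
    · rfl
    · exact absurd ⟨s, h1, h2⟩ hm
    · exact absurd ⟨s, h2, h1⟩ hm
    · rfl
  · have hV : ∀ i < k, a i = p.1.1 ∧ b i = p.1.2 ∨ a i = q.1.1 ∧ b i = q.1.2 := by
      intro i hi
      simpa [Prod.ext_iff] using (hpath i hi).1
    have key : ∀ r r' : HassePair K, r.1.2 ≠ r'.1.2 → r.1.1 ⊆ r'.1.2 → r'.1.1 ⊆ r.1.2 →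
        r.1.1.card = r'.1.1.card → r.1.1 ≠ r'.1.1 → False := by
      intro r r' h h1 h2 h3 h4
      have h5 : ∀ t : Finset γ, r.1.1 ⊆ t → r'.1.1 ⊆ t → t.card = r.1.1.card + 1 →
          r.1.1 ∪ r'.1.1 = t := by
        intro t ht ht' hc
        refine Finset.eq_of_subset_of_card_le (Finset.union_subset ht ht') ?_
        rw [hc]
        by_contra hlt
        have h6 := Finset.eq_of_subset_of_card_le
          (Finset.subset_union_left : r.1.1 ⊆ r.1.1 ∪ r'.1.1) (by omega)
        have h7 : r'.1.1 ⊆ r.1.1 := h6 ▸ Finset.subset_union_right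
        exact h4 (Finset.eq_of_subset_of_card_le h7 h3.le).symm
      exact h ((h5 _ r.2.2.2.1 h2 r.2.2.2.2).symm.trans
        (h5 _ h1 r'.2.2.2.1 (h3 ▸ r'.2.2.2.2)))
    have h0 := hpath 0 hk
    rw [zero_add] at h0
    rcases (show k = 1 ∨ 1 < k by omega) with rfl | hk'
    · exact h0.2.2.2 hclosed
    have h1 := hpath 1 hk'
    have h2 : a 2 = p.1.1 ∨ a 2 = q.1.1 := by
      rcases (show k = 2 ∨ 2 < k by omega) with rfl | hk''
      · rw [hclosed]; exact (hV 0 hk).imp And.left And.left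
      · exact (hV 2 hk'').imp And.left And.left
    have h3 := h1.2.2.2
    rcases hV 0 hk with ⟨e1, e2⟩ | ⟨e1, e2⟩ <;> rcases hV 1 hk' with ⟨e3, e4⟩ | ⟨e3, e4⟩
    · exact h0.2.2.2 (e3.trans e1.symm)
    · have e5 : a 2 = p.1.1 := h2.resolve_right fun h => h3 (h.trans e3.symm)
      exact key p q hdisj.2 (e5 ▸ e4 ▸ h1.2.1) (e3 ▸ e2 ▸ h0.2.1)
        (e1 ▸ e3 ▸ h0.2.2.1.symm) hdisj.1
    · have e5 : a 2 = q.1.1 := h2.resolve_left fun h => h3 (h.trans e3.symm)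
      exact key q p hdisj.2.symm (e5 ▸ e4 ▸ h1.2.1) (e3 ▸ e2 ▸ h0.2.1)
        (e1 ▸ e3 ▸ h0.2.2.1.symm) hdisj.1.symm
    · exact h0.2.2.2 (e3.trans e1.symm)

lemma Meets.symm {p q : Finset γ × Finset γ} (h : Meets p q) : Meets q p :=
  h.imp fun _ hs => ⟨hs.2, hs.1⟩

/-- An automorphism of the Morse complex, as a permutation of the pairs. -/
def pairPerm (f : Equiv.Perm K.morseComplex.vertices) : Equiv.Perm (HassePair K) :=
  (Equiv.subtypeEquivRight fun _ => mem_vertices_morseComplex).permCongr f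

lemma meets_pairPerm_iff {f : Equiv.Perm K.morseComplex.vertices} (hf : f ∈ K.morseComplex.Aut)
    (p q : HassePair K) : Meets p.1 q.1 ↔ Meets (pairPerm f p).1 (pairPerm f q).1 := by
  classical
  by_cases hpq : p = q
  · subst hpq
    exact iff_of_true ⟨_, Or.inl rfl, Or.inl rfl⟩ ⟨_, Or.inl rfl, Or.inl rfl⟩
  rw [← not_iff_not, ← pair_mem_morseComplex_iff hpq,
    ← pair_mem_morseComplex_iff ((pairPerm f).injective.ne hpq)]
  have h := hf {⟨p.1, mem_vertices_morseComplex.2 p.2⟩, ⟨q.1, mem_vertices_morseComplex.2 q.2⟩}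
  simp only [Finset.map_insert, Finset.map_singleton, Equiv.coe_toEmbedding,
    Function.Embedding.subtype_apply] at h
  exact h.symm

/-- The line graph of the Hasse diagram of a connected complex is connected. -/
lemma HassePair.induction (hK : K.IsConnected) {P : HassePair K → Prop}
    (h : ∀ p q : HassePair K, Meets p.1 q.1 → P p → P q) (p q : HassePair K) (hp : P p) : P q := by
  classical
  have hiff : ∀ p q : HassePair K, Meets p.1 q.1 → (P p ↔ P q) := fun p q hm =>
    ⟨h p q hm, h q p hm.symm⟩
  have hdown : ∀ p : HassePair K, ∃ (v w : γ) (hvw : v ≠ w) (hK : {v, w} ∈ K),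
      P p ↔ P ⟨({v}, {v, w}), singleton_mem hK (by simp), hK, covers_singleton_pair hvw⟩ := by
    intro p
    induction hn : p.1.1.card generalizing p with
    | zero => exact absurd hn (nonempty_of_mem p.2.1).card_pos.ne'
    | succ n ih =>
      obtain ⟨⟨s, t⟩, hs, ht, hst⟩ := p
      change s.card = n + 1 at hn
      rcases Nat.eq_zero_or_pos n with rfl | hn0
      · obtain ⟨v, rfl⟩ := Finset.card_eq_one.1 hn
        obtain ⟨w, hvw, rfl⟩ := exists_eq_pair_of_hasseAdj ht (Or.inl hst)
        exact ⟨v, w, hvw, ht, Iff.rfl⟩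
      · obtain ⟨a, ha⟩ := nonempty_of_mem hs
        have h1 : (s.erase a).card + 1 = s.card := Finset.card_erase_add_one ha
        have h2 : 0 < (s.erase a).card := by omega
        have hm : s.erase a ∈ K := mem_of_subset hs (Finset.erase_subset _ _)
          (Finset.card_pos.1 h2)
        obtain ⟨v, w, hvw, hK, hP⟩ := ih ⟨(s.erase a, s), hm, hs, Finset.erase_subset _ _, h1.symm⟩
          (show (s.erase a).card = n by omega)
        exact ⟨v, w, hvw, hK, (hiff _ _ ⟨s, Or.inl rfl, Or.inr rfl⟩).trans hP⟩
  obtain ⟨v, w, hvw, hvwK, h1⟩ := hdown p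
  obtain ⟨x, y, hxy, hxyK, h2⟩ := hdown q
  rw [h2]
  have h3 := h1.1 hp
  have key := hK.induction (P := fun v => ∀ (w : γ) (hvw : v ≠ w) (hK : {v, w} ∈ K),
      P ⟨({v}, {v, w}), singleton_mem hK (by simp), hK, covers_singleton_pair hvw⟩)
    (fun a b hab habK hPa c hbc hbcK => ?_) (singleton_mem hvwK (a := v) (by simp))
    (singleton_mem hxyK (a := x) (by simp))
    (fun u hvu hvuK => h _ _ ⟨{v}, Or.inl rfl, Or.inl rfl⟩ h3)
  · exact key y hxy hxyK
  · have h4 := hPa b hab habK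
    have hbaK : {b, a} ∈ K := Finset.pair_comm a b ▸ habK
    have h5 := h _ ⟨({b}, {b, a}), singleton_mem hbaK (by simp), hbaK,
      covers_singleton_pair hab.symm⟩ ⟨{a, b}, Or.inr rfl, Or.inr (Finset.pair_comm a b)⟩ h4
    exact h _ _ ⟨{b}, Or.inl rfl, Or.inl rfl⟩ h5

/-! ### Automorphisms induced on the Morse complex -/

/-- The permutation of pairs of finite sets induced by a permutation of the points. -/
def mapPairs (π : Equiv.Perm γ) : Equiv.Perm (Finset γ × Finset γ) :=
  Equiv.prodCongr π.finsetCongr π.finsetCongr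

lemma mapPairs_apply (π : Equiv.Perm γ) (p : Finset γ × Finset γ) :
    mapPairs π p = (p.1.map π.toEmbedding, p.2.map π.toEmbedding) := rfl

lemma map_mul_toEmbedding (π ρ : Equiv.Perm γ) (s : Finset γ) :
    s.map (π * ρ).toEmbedding = (s.map ρ.toEmbedding).map π.toEmbedding := by
  rw [Finset.map_map]; rfl

lemma mapPairs_mul (π ρ : Equiv.Perm γ) : mapPairs (π * ρ) = mapPairs π * mapPairs ρ := by
  ext1 p
  rw [Equiv.Perm.mul_apply, mapPairs_apply, mapPairs_apply, mapPairs_apply, map_mul_toEmbedding,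
    map_mul_toEmbedding]

lemma mapPairs_one : mapPairs (1 : Equiv.Perm γ) = 1 := by
  ext1 p
  exact Prod.ext Finset.map_refl Finset.map_refl

lemma mapPairs_inv (π : Equiv.Perm γ) : mapPairs π⁻¹ = (mapPairs π)⁻¹ :=
  eq_inv_of_mul_eq_one_left (by rw [← mapPairs_mul, inv_mul_cancel, mapPairs_one])

lemma isGradientVectorField_map {π : Equiv.Perm γ}
    (hπ : ∀ s ∈ K, s.map π.toEmbedding ∈ K) {V : Finset (Finset γ × Finset γ)}
    (hV : IsGradientVectorField K V) :
    IsGradientVectorField K (V.map (mapPairs π).toEmbedding) := by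
  have hinj : ∀ s t : Finset γ, s.map π.toEmbedding = t.map π.toEmbedding ↔ s = t := fun s t =>
    Finset.map_inj
  refine ⟨⟨?_, ?_⟩, ?_⟩
  · intro p hp
    obtain ⟨p, hp', rfl⟩ := Finset.mem_map.1 hp
    obtain ⟨h1, h2, h3, h4⟩ := hV.1.1 p hp'
    refine ⟨hπ _ h1, hπ _ h2, Finset.map_subset_map.2 h3, ?_⟩
    simpa [mapPairs_apply] using h4
  · intro p hp q hq s hs hs'
    obtain ⟨p, hp', rfl⟩ := Finset.mem_map.1 hp
    obtain ⟨q, hq', rfl⟩ := Finset.mem_map.1 hq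
    simp only [Equiv.coe_toEmbedding, mapPairs_apply] at hs hs'
    obtain ⟨t, ht, rfl⟩ : ∃ t, (t = p.1 ∨ t = p.2) ∧ s = t.map π.toEmbedding := by
      rcases hs with rfl | rfl
      exacts [⟨_, Or.inl rfl, rfl⟩, ⟨_, Or.inr rfl, rfl⟩]
    rw [hinj, hinj] at hs'
    rw [hV.1.2 p hp' q hq' t ht hs']
  · intro k a b hk hpath hclosed
    refine hV.2 k (fun i => (a i).map (π⁻¹).toEmbedding) (fun i => (b i).map (π⁻¹).toEmbedding) hk
      (fun i hi => ?_) (by simp only [hclosed])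
    obtain ⟨h1, h2, h3, h4⟩ := hpath i hi
    refine ⟨?_, Finset.map_subset_map.2 h2, by simpa using h3, fun h => h4 (Finset.map_inj.1 h)⟩
    obtain ⟨p, hp, hpe⟩ := Finset.mem_map.1 h1
    have h5 : mapPairs π⁻¹ (a i, b i) = p := by
      rw [mapPairs_inv, ← hpe]
      exact (mapPairs π).symm_apply_apply p
    change mapPairs π⁻¹ (a i, b i) ∈ V
    rwa [h5]

lemma map_mem_iff_of_inv {π : Equiv.Perm γ} (hπ : ∀ s ∈ K, s.map π.toEmbedding ∈ K)
    (hπ' : ∀ s ∈ K, s.map (π⁻¹).toEmbedding ∈ K) (s : Finset γ) :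
    s.map π.toEmbedding ∈ K ↔ s ∈ K := by
  refine ⟨fun h => ?_, hπ s⟩
  have := hπ' _ h
  rwa [← map_mul_toEmbedding, inv_mul_cancel, show (1 : Equiv.Perm γ).toEmbedding =
    Function.Embedding.refl _ from rfl, Finset.map_refl] at this

lemma map_mapPairs_mem_morseComplex_iff {π : Equiv.Perm γ}
    (hπ : ∀ s ∈ K, s.map π.toEmbedding ∈ K) (hπ' : ∀ s ∈ K, s.map (π⁻¹).toEmbedding ∈ K)
    (V : Finset (Finset γ × Finset γ)) :
    V.map (mapPairs π).toEmbedding ∈ K.morseComplex ↔ V ∈ K.morseComplex :=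
  map_mem_iff_of_inv (K := K.morseComplex)
    (fun _ hV => ⟨hV.1.map, isGradientVectorField_map hπ hV.2⟩)
    (fun _ hV => by
      rw [← mapPairs_inv]
      exact ⟨hV.1.map, isGradientVectorField_map hπ' hV.2⟩) V

lemma mapPairs_mem_vertices_iff {π : Equiv.Perm γ}
    (hπ : ∀ s ∈ K, s.map π.toEmbedding ∈ K) (hπ' : ∀ s ∈ K, s.map (π⁻¹).toEmbedding ∈ K)
    (p : Finset γ × Finset γ) :
    mapPairs π p ∈ K.morseComplex.vertices ↔ p ∈ K.morseComplex.vertices := by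
  have := map_mapPairs_mem_morseComplex_iff hπ hπ' {p}
  rwa [Finset.map_singleton] at this

lemma subtypePerm_mapPairs_mem_aut {π : Equiv.Perm γ}
    (hπ : ∀ s ∈ K, s.map π.toEmbedding ∈ K) (hπ' : ∀ s ∈ K, s.map (π⁻¹).toEmbedding ∈ K) :
    (mapPairs π).subtypePerm (mapPairs_mem_vertices_iff hπ hπ') ∈ K.morseComplex.Aut := by
  intro s
  rw [← map_mapPairs_mem_morseComplex_iff hπ hπ' (s.map _), Finset.map_map, Finset.map_map]
  rfl

open Classical in
/-- An automorphism of a complex, extended by the identity to the ambient type. -/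
noncomputable def extend (g : K.Aut) : Equiv.Perm γ := Equiv.Perm.ofSubtype g.1

lemma extend_mul (g h : K.Aut) : extend (g * h) = extend g * extend h :=
  map_mul _ _ _

lemma extend_inv (g : K.Aut) : (extend g)⁻¹ = extend g⁻¹ :=
  (map_inv _ _).symm

open Classical in
lemma extend_apply (g : K.Aut) (v : K.vertices) : extend g v = g.1 v :=
  Equiv.Perm.ofSubtype_apply_coe _ _

lemma map_extend_mem (g : K.Aut) {s : Finset γ} (hs : s ∈ K) :
    s.map (extend g).toEmbedding ∈ K := by
  classical
  obtain ⟨t, rfl⟩ : ∃ t : Finset K.vertices, t.map (Function.Embedding.subtype _) = s :=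
    ⟨s.subtype _, Finset.subtype_map_of_mem fun v hv => singleton_mem hs hv⟩
  have h := (g.2 t).2 hs
  suffices (t.map (Function.Embedding.subtype _)).map (extend g).toEmbedding =
      (t.map g.1.toEmbedding).map (Function.Embedding.subtype _) by rwa [this]
  rw [Finset.map_map, Finset.map_map]
  congr 1
  ext v
  exact extend_apply g v

end Morse

/-! ### Disjoint unions -/

section DisjUnion

variable {α β : Type*} {K₁ : PreAbstractSimplicialComplex α} {K₂ : PreAbstractSimplicialComplex β}

/-- A pair of `K₁` as a pair of the disjoint union. -/
def inlPair (p : HassePair K₁) : HassePair (K₁.disjUnion K₂) :=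
  ⟨(p.1.1.map .inl, p.1.2.map .inl), Or.inl ⟨_, p.2.1, rfl⟩, Or.inl ⟨_, p.2.2.1, rfl⟩,
    Finset.map_subset_map.2 p.2.2.2.1, by simpa using p.2.2.2.2⟩

/-- A pair of `K₂` as a pair of the disjoint union. -/
def inrPair (p : HassePair K₂) : HassePair (K₁.disjUnion K₂) :=
  ⟨(p.1.1.map .inr, p.1.2.map .inr), Or.inr ⟨_, p.2.1, rfl⟩, Or.inr ⟨_, p.2.2.1, rfl⟩,
    Finset.map_subset_map.2 p.2.2.2.1, by simpa using p.2.2.2.2⟩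

lemma map_inl_ne_map_inr {s : Finset α} (hs : s.Nonempty) (t : Finset β) :
    s.map (.inl : α ↪ α ⊕ β) ≠ t.map .inr := by
  intro h
  obtain ⟨a, ha⟩ := hs
  have h1 : Sum.inl a ∈ s.map (.inl : α ↪ α ⊕ β) := Finset.mem_map_of_mem _ ha
  rw [h] at h1
  simp at h1

lemma bijective_sum_elim_inlPair_inrPair :
    Function.Bijective (Sum.elim inlPair inrPair :
      HassePair K₁ ⊕ HassePair K₂ → HassePair (K₁.disjUnion K₂)) := by
  constructor
  · rintro (p | p) (q | q) h
    · have h1 := congrArg Subtype.val h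
      simp only [Sum.elim_inl, inlPair, Prod.mk.injEq, Finset.map_inj] at h1
      rw [Subtype.ext (Prod.ext h1.1 h1.2)]
    · exact absurd (congrArg (fun r => r.1.1) h)
        (map_inl_ne_map_inr (nonempty_of_mem p.2.1) q.1.1)
    · exact absurd (congrArg (fun r => r.1.1) h).symm
        (map_inl_ne_map_inr (nonempty_of_mem q.2.1) p.1.1)
    · have h1 := congrArg Subtype.val h
      simp only [Sum.elim_inr, inrPair, Prod.mk.injEq, Finset.map_inj] at h1
      rw [Subtype.ext (Prod.ext h1.1 h1.2)]
  · rintro ⟨⟨s, t⟩, hs, ht, hst, hc⟩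
    rcases id ht with ⟨t, ht', rfl⟩ | ⟨t, ht', rfl⟩
    · obtain ⟨s, hs', rfl⟩ := Finset.subset_map_iff.1 hst
      refine ⟨Sum.inl ⟨(s, t), mem_of_subset ht' hs' ?_, ht', hs', by simpa using hc⟩, rfl⟩
      exact Finset.map_nonempty.1 (nonempty_of_mem hs)
    · obtain ⟨s, hs', rfl⟩ := Finset.subset_map_iff.1 hst
      refine ⟨Sum.inr ⟨(s, t), mem_of_subset ht' hs' ?_, ht', hs', by simpa using hc⟩, rfl⟩
      exact Finset.map_nonempty.1 (nonempty_of_mem hs)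

/-- The decomposition of the pairs of a disjoint union. -/
noncomputable def sumPairEquiv : HassePair K₁ ⊕ HassePair K₂ ≃ HassePair (K₁.disjUnion K₂) :=
  Equiv.ofBijective _ bijective_sum_elim_inlPair_inrPair

lemma meets_inlPair_iff (p q : HassePair K₁) :
    Meets (inlPair (K₂ := K₂) p).1 (inlPair (K₂ := K₂) q).1 ↔ Meets p.1 q.1 := by
  constructor
  · rintro ⟨s, h1, h2⟩
    simp only [inlPair] at h1 h2
    rcases h1 with rfl | rfl <;> simp only [Finset.map_inj] at h2
    exacts [⟨_, Or.inl rfl, h2⟩, ⟨_, Or.inr rfl, h2⟩]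
  · rintro ⟨s, h1, h2⟩
    refine ⟨s.map .inl, ?_⟩
    simp only [inlPair, Finset.map_inj]
    exact ⟨h1, h2⟩

lemma meets_inrPair_iff (p q : HassePair K₂) :
    Meets (inrPair (K₁ := K₁) p).1 (inrPair (K₁ := K₁) q).1 ↔ Meets p.1 q.1 := by
  constructor
  · rintro ⟨s, h1, h2⟩
    simp only [inrPair] at h1 h2
    rcases h1 with rfl | rfl <;> simp only [Finset.map_inj] at h2
    exacts [⟨_, Or.inl rfl, h2⟩, ⟨_, Or.inr rfl, h2⟩]
  · rintro ⟨s, h1, h2⟩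
    refine ⟨s.map .inr, ?_⟩
    simp only [inrPair, Finset.map_inj]
    exact ⟨h1, h2⟩

lemma not_meets_inlPair_inrPair (p : HassePair K₁) (q : HassePair K₂) :
    ¬ Meets (inlPair (K₂ := K₂) p).1 (inrPair (K₁ := K₁) q).1 := by
  rintro ⟨s, h1 | h1, h2 | h2⟩
  · exact map_inl_ne_map_inr (nonempty_of_mem p.2.1) _ (h1.symm.trans h2)
  · exact map_inl_ne_map_inr (nonempty_of_mem p.2.1) _ (h1.symm.trans h2)
  · exact map_inl_ne_map_inr (nonempty_of_mem p.2.2.1) _ (h1.symm.trans h2)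
  · exact map_inl_ne_map_inr (nonempty_of_mem p.2.2.1) _ (h1.symm.trans h2)

lemma map_sumCongr_mem {π₁ : Equiv.Perm α} {π₂ : Equiv.Perm β}
    (h₁ : ∀ s ∈ K₁, s.map π₁.toEmbedding ∈ K₁) (h₂ : ∀ s ∈ K₂, s.map π₂.toEmbedding ∈ K₂)
    (s : Finset (α ⊕ β)) (hs : s ∈ K₁.disjUnion K₂) :
    s.map (Equiv.Perm.sumCongr π₁ π₂).toEmbedding ∈ K₁.disjUnion K₂ := by
  rcases hs with ⟨t, ht, rfl⟩ | ⟨t, ht, rfl⟩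
  · refine Or.inl ⟨_, h₁ t ht, ?_⟩
    rw [Finset.map_map, Finset.map_map]; rfl
  · refine Or.inr ⟨_, h₂ t ht, ?_⟩
    rw [Finset.map_map, Finset.map_map]; rfl

/-- The permutation of the ambient type of `K₁ ⊔ K₂` given by two automorphisms. -/
noncomputable def sumPerm (g : K₁.Aut × K₂.Aut) : Equiv.Perm (α ⊕ β) :=
  Equiv.Perm.sumCongr (extend g.1) (extend g.2)

lemma map_sumPerm_mem (g : K₁.Aut × K₂.Aut) :
    ∀ s ∈ K₁.disjUnion K₂, s.map (sumPerm g).toEmbedding ∈ K₁.disjUnion K₂ :=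
  map_sumCongr_mem (fun _ => map_extend_mem _) (fun _ => map_extend_mem _)

lemma sumPerm_inv (g : K₁.Aut × K₂.Aut) : (sumPerm g)⁻¹ = sumPerm g⁻¹ := by
  rw [sumPerm, sumPerm, Equiv.Perm.sumCongr_inv, extend_inv, extend_inv]; rfl

lemma map_sumPerm_inv_mem (g : K₁.Aut × K₂.Aut) :
    ∀ s ∈ K₁.disjUnion K₂, s.map ((sumPerm g)⁻¹).toEmbedding ∈ K₁.disjUnion K₂ := by
  rw [sumPerm_inv]; exact map_sumPerm_mem _

lemma sumPerm_mul (g h : K₁.Aut × K₂.Aut) : sumPerm (g * h) = sumPerm g * sumPerm h := by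
  simp only [sumPerm, Equiv.Perm.sumCongr_mul, Prod.fst_mul, Prod.snd_mul, extend_mul]

variable (K₁ K₂) in
/-- The action of `Aut K₁ × Aut K₂` on the Morse complex of `K₁ ⊔ K₂`. -/
noncomputable def autProdToMorse : K₁.Aut × K₂.Aut →* (K₁.disjUnion K₂).morseComplex.Aut :=
  MonoidHom.mk' (fun g => ⟨_, subtypePerm_mapPairs_mem_aut (map_sumPerm_mem g)
    (map_sumPerm_inv_mem g)⟩) fun g h => by
      apply Subtype.ext
      ext1 p
      apply Subtype.ext
      change mapPairs (sumPerm (g * h)) p.1 = mapPairs (sumPerm g) (mapPairs (sumPerm h) p.1)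
      rw [sumPerm_mul, mapPairs_mul]; rfl

lemma autProdToMorse_apply (g : K₁.Aut × K₂.Aut) (p : (K₁.disjUnion K₂).morseComplex.vertices) :
    ((autProdToMorse K₁ K₂ g).1 p).1 = mapPairs (sumPerm g) p.1 := rfl

lemma mapPairs_sumPerm_inlPair (g : K₁.Aut × K₂.Aut) (p : HassePair K₁) :
    mapPairs (sumPerm g) (inlPair (K₂ := K₂) p).1 =
      ((mapPairs (extend g.1) p.1).1.map .inl, (mapPairs (extend g.1) p.1).2.map .inl) := by
  simp only [mapPairs_apply, inlPair, Finset.map_map]; rfl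

lemma mapPairs_sumPerm_inrPair (g : K₁.Aut × K₂.Aut) (p : HassePair K₂) :
    mapPairs (sumPerm g) (inrPair (K₁ := K₁) p).1 =
      ((mapPairs (extend g.2) p.1).1.map .inr, (mapPairs (extend g.2) p.1).2.map .inr) := by
  simp only [mapPairs_apply, inrPair, Finset.map_map]; rfl

lemma IsConnected.subsingleton_vertices (hK : K₁.IsConnected) [h : IsEmpty (HassePair K₁)] :
    Subsingleton K₁.vertices := by
  classical
  refine ⟨fun v w => Subtype.ext ?_⟩
  refine (hK.induction (P := fun x => x = v) ?_ v.2 w.2 rfl).symm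
  rintro _ y hy hyK rfl
  exact h.elim ⟨({(v : α)}, {(v : α), y}), v.2, hyK, covers_singleton_pair hy⟩

/-- An automorphism is determined by its action on the pairs. -/
lemma eq_one_of_mapPairs_extend (hK : K₁.IsConnected) (g : K₁.Aut)
    (hg : ∀ p : HassePair K₁, mapPairs (extend g) p.1 = p.1) : g = 1 := by
  classical
  apply Subtype.ext
  rcases isEmpty_or_nonempty (HassePair K₁) with h | ⟨⟨p₀⟩⟩
  · have := hK.subsingleton_vertices
    exact Subsingleton.elim _ _
  · ext v
    obtain ⟨w, hvw, hw⟩ := hK.exists_edge p₀ v.2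
    have h1 := congrArg Prod.fst (hg ⟨({(v : α)}, {(v : α), w}), v.2, hw,
      covers_singleton_pair hvw⟩)
    simp only [mapPairs_apply, Finset.map_singleton, Equiv.coe_toEmbedding, extend_apply] at h1
    exact Finset.singleton_injective h1

lemma injective_autProdToMorse (h₁ : K₁.IsConnected) (h₂ : K₂.IsConnected) :
    Function.Injective (autProdToMorse K₁ K₂) := by
  rw [injective_iff_map_eq_one]
  intro g hg
  have hfix : ∀ p : HassePair (K₁.disjUnion K₂), mapPairs (sumPerm g) p.1 = p.1 := by
    intro p
    have := autProdToMorse_apply g ⟨p.1, mem_vertices_morseComplex.2 p.2⟩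
    rw [hg] at this
    exact this.symm
  refine Prod.ext (eq_one_of_mapPairs_extend h₁ _ fun p => ?_)
    (eq_one_of_mapPairs_extend h₂ _ fun p => ?_)
  · have := hfix (inlPair p)
    rw [mapPairs_sumPerm_inlPair] at this
    simp only [inlPair, Prod.mk.injEq, Finset.map_inj] at this
    exact Prod.ext this.1 this.2
  · have := hfix (inrPair p)
    rw [mapPairs_sumPerm_inrPair] at this
    simp only [inrPair, Prod.mk.injEq, Finset.map_inj] at this
    exact Prod.ext this.1 this.2

lemma finite_hassePair (hfin : K₁.faces.Finite) : Finite (HassePair K₁) := by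
  have : Finite K₁.faces := hfin.to_subtype
  refine Finite.of_injective (β := K₁.faces × K₁.faces)
    (fun p => (⟨p.1.1, p.2.1⟩, ⟨p.1.2, p.2.2.1⟩)) fun p q h => ?_
  simp only [Prod.mk.injEq, Subtype.mk.injEq] at h
  exact Subtype.ext (Prod.ext h.1 h.2)

lemma exists_aut_of_meets_iff (hfin : K₁.faces.Finite) (hK : K₁.IsConnected)
    (hbd : ∀ n : ℕ, ¬ K₁.Isomorphic (simplexBoundary n))
    (hcyc : ∀ n : ℕ, 3 ≤ n → ¬ K₁.Isomorphic (cycle n)) (F : Equiv.Perm (HassePair K₁))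
    (hF : ∀ p q, Meets p.1 q.1 ↔ Meets (F p).1 (F q).1) :
    ∃ g : K₁.Aut, ∀ p, (F p).1 = mapPairs (extend g) p.1 := by
  classical
  rcases isEmpty_or_nonempty (HassePair K₁) with h | ⟨⟨p₀⟩⟩
  · exact ⟨1, fun p => h.elim p⟩
  · obtain ⟨e, he, hFe⟩ := exists_isIsomorphism_of_meets_iff hfin hK hK hbd hcyc p₀ F hF
    refine ⟨⟨e, he⟩, fun p => ?_⟩
    have key : ∀ s ∈ K₁, ∀ t : Finset α,
        (∀ b, b ∈ t ↔ ∃ a : K₁.vertices, (a : α) ∈ s ∧ (e a : α) = b) →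
        t = s.map (extend (K := K₁) ⟨e, he⟩).toEmbedding := by
      intro s hs t ht
      ext b
      rw [ht]
      simp only [Finset.mem_map, Equiv.coe_toEmbedding]
      constructor
      · rintro ⟨a, ha, rfl⟩
        exact ⟨a, ha, extend_apply _ a⟩
      · rintro ⟨a, ha, rfl⟩
        exact ⟨⟨a, singleton_mem hs ha⟩, ha,
          (extend_apply (K := K₁) ⟨e, he⟩ ⟨a, singleton_mem hs ha⟩).symm⟩
    exact Prod.ext (key _ p.2.1 _ fun b => (hFe p b).1) (key _ p.2.2.1 _ fun b => (hFe p b).2)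

/-- A permutation of the pairs of `K₁ ⊔ K₂` which preserves the relation of having a common
simplex permutes the connected components of the line graph of the Hasse diagram; if it maps some
pair of `K₁` to a pair of `K₂`, then it exchanges all of them. -/
lemma exists_equiv_of_apply_inl_eq_inr (h₁ : K₁.IsConnected) (h₂ : K₂.IsConnected)
    (S : Equiv.Perm (HassePair K₁ ⊕ HassePair K₂))
    (hS : ∀ p q, Meets (sumPairEquiv p).1 (sumPairEquiv q).1 ↔
      Meets (sumPairEquiv (S p)).1 (sumPairEquiv (S q)).1)
    {p₀ : HassePair K₁} {q₀ : HassePair K₂} (h₀ : S (.inl p₀) = .inr q₀) :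
    ∃ F : HassePair K₁ ≃ HassePair K₂, ∀ p q, Meets p.1 q.1 ↔ Meets (F p).1 (F q).1 := by
  have hl : ∀ p, ∃ q, S (.inl p) = .inr q := fun p => by
    refine HassePair.induction h₁ (P := fun p => ∃ q, S (.inl p) = .inr q) ?_ p₀ p ⟨q₀, h₀⟩
    rintro a b hab ⟨q, hq⟩
    have h := (hS (.inl a) (.inl b)).1 ((meets_inlPair_iff a b).2 hab)
    rcases hb : S (.inl b) with r | r
    · rw [hq, hb] at h
      exact absurd h.symm (not_meets_inlPair_inrPair r q)
    · exact ⟨r, rfl⟩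
  have hr : ∀ q, ∃ p, S (.inl p) = .inr q := fun q => by
    refine HassePair.induction h₂ (P := fun q => ∃ p, S (.inl p) = .inr q) ?_ q₀ q ⟨p₀, h₀⟩
    rintro a b hab ⟨p, hp⟩
    have h := (hS (.inl p) (S.symm (.inr b))).2 (by
      rw [hp, Equiv.apply_symm_apply]
      exact (meets_inrPair_iff a b).2 hab)
    rcases hb : S.symm (.inr b) with r | r
    · exact ⟨r, ((Equiv.symm_apply_eq _).1 hb).symm⟩
    · rw [hb] at h
      exact absurd h (not_meets_inlPair_inrPair p r)
  choose F hF using hl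
  have hbij : Function.Bijective F := by
    constructor
    · intro p q hpq
      have : S (.inl p) = S (.inl q) := by rw [hF, hF, hpq]
      exact Sum.inl_injective (S.injective this)
    · intro q
      obtain ⟨p, hp⟩ := hr q
      exact ⟨p, Sum.inr_injective ((hF p).symm.trans hp)⟩
  refine ⟨Equiv.ofBijective F hbij, fun p q => ?_⟩
  rw [← meets_inlPair_iff (K₂ := K₂)]
  refine (hS (.inl p) (.inl q)).trans ?_
  rw [hF, hF]
  exact meets_inrPair_iff _ _

/-- A complex is the join of itself with the empty complex. -/
lemma isFullyConnected_self (K : PreAbstractSimplicialComplex α) : K.IsFullyConnected K := by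
  have hdel : ∀ s, s ∉ deletion K K := by
    rintro s ⟨hs, h⟩
    obtain ⟨v, hv⟩ := nonempty_of_mem hs
    exact h v hv (singleton_mem hs hv)
  have hjoin : ∀ s : Finset (α ⊕ α), s ∈ join K (deletion K K) ↔ ∃ t ∈ K, t.map .inl = s := by
    intro s
    constructor
    · rintro ⟨hne, h1, h2⟩
      have h2' : s.toRight = ∅ := h2.resolve_right (hdel _)
      have hs : s.toLeft.map .inl = s := by
        ext (x | x)
        · simp
        · have : x ∉ s.toRight := by simp [h2']
          simpa using this
      refine ⟨_, h1.resolve_left fun h => ?_, hs⟩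
      rw [← hs, h] at hne
      simp at hne
    · rintro ⟨t, ht, rfl⟩
      refine ⟨(nonempty_of_mem ht).map, Or.inr ?_, Or.inl ?_⟩
      · suffices (t.map (.inl : α ↪ α ⊕ α)).toLeft = t by rwa [this]
        ext x; simp
      · ext x; simp
  have hvert : ∀ x : α ⊕ α, x ∈ (join K (deletion K K)).vertices ↔
      ∃ v : K.vertices, Sum.inl (v : α) = x := by
    intro x
    change {x} ∈ join K (deletion K K) ↔ _
    rw [hjoin]
    constructor
    · rintro ⟨t, ht, h⟩
      have hx : x ∈ t.map .inl := by rw [h]; simp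
      obtain ⟨v, hv, rfl⟩ := Finset.mem_map.1 hx
      exact ⟨⟨v, singleton_mem ht hv⟩, rfl⟩
    · rintro ⟨v, rfl⟩
      exact ⟨{(v : α)}, v.2, rfl⟩
  refine ⟨le_rfl, Equiv.ofBijective (fun v => ⟨Sum.inl (v : α), (hvert _).2 ⟨v, rfl⟩⟩)
    ⟨fun v w h => ?_, ?_⟩, fun s => ?_⟩
  · exact Subtype.ext (Sum.inl_injective (congrArg Subtype.val h))
  · rintro ⟨x, hx⟩
    obtain ⟨v, rfl⟩ := (hvert _).1 hx
    exact ⟨v, rfl⟩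
  · rw [hjoin, Finset.map_map]
    constructor
    · rintro ⟨t, ht, h⟩
      suffices t = s.map (Function.Embedding.subtype _) by rwa [← this]
      apply Finset.map_injective (.inl : α ↪ α ⊕ α)
      rw [h, Finset.map_map]; rfl
    · intro h
      refine ⟨_, h, ?_⟩
      rw [Finset.map_map]; rfl

/-- Both components of the line graph are preserved, for otherwise `K₁ ≅ K₂`; hence an automorphism
of the Morse complex restricts to the pairs of `K₁` and to those of `K₂`. -/
lemma surjective_autProdToMorse (hfin₁ : K₁.faces.Finite) (hfin₂ : K₂.faces.Finite)
    (h₁ : K₁.IsConnected) (h₂ : K₂.IsConnected)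
    (hbd₁ : ∀ n : ℕ, ¬ K₁.Isomorphic (simplexBoundary n))
    (hbd₂ : ∀ n : ℕ, ¬ K₂.Isomorphic (simplexBoundary n))
    (hcyc₁ : ∀ n : ℕ, 3 ≤ n → ¬ K₁.Isomorphic (cycle n))
    (hcyc₂ : ∀ n : ℕ, 3 ≤ n → ¬ K₂.Isomorphic (cycle n))
    (hiso : ¬ K₁.Isomorphic K₂) : Function.Surjective (autProdToMorse K₁ K₂) := by
  classical
  intro f
  let S : Equiv.Perm (HassePair K₁ ⊕ HassePair K₂) :=
    (sumPairEquiv.trans (pairPerm f.1)).trans sumPairEquiv.symm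
  have hSapp : ∀ p, sumPairEquiv (S p) = pairPerm f.1 (sumPairEquiv p) := fun p => by
    simp [S]
  have hS : ∀ p q, Meets (sumPairEquiv p).1 (sumPairEquiv q).1 ↔
      Meets (sumPairEquiv (S p)).1 (sumPairEquiv (S q)).1 := fun p q => by
    rw [hSapp, hSapp]; exact meets_pairPerm_iff f.2 _ _
  have hnot : ∀ (p : HassePair K₁) (q : HassePair K₂), S (.inl p) ≠ .inr q := by
    intro p q h
    obtain ⟨F, hF⟩ := exists_equiv_of_apply_inl_eq_inr h₁ h₂ S hS h
    obtain ⟨e, he, -⟩ := exists_isIsomorphism_of_meets_iff hfin₁ h₁ h₂ hbd₁ hcyc₁ p F hF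
    exact hiso ⟨e, he⟩
  have := finite_hassePair hfin₁
  have := finite_hassePair hfin₂
  obtain ⟨⟨F₁, F₂⟩, hF⟩ := Equiv.Perm.mem_sumCongrHom_range_of_perm_mapsTo_inl (σ := S) (by
    rintro _ ⟨p, rfl⟩
    rcases h : S (.inl p) with q | q
    · exact ⟨q, rfl⟩
    · exact absurd h (hnot p q))
  have hF₁ : ∀ p, S (.inl p) = .inl (F₁ p) := fun p => by rw [← hF]; rfl
  have hF₂ : ∀ p, S (.inr p) = .inr (F₂ p) := fun p => by rw [← hF]; rfl
  obtain ⟨g₁, hg₁⟩ := exists_aut_of_meets_iff hfin₁ h₁ hbd₁ hcyc₁ F₁ fun p q => by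
    rw [← meets_inlPair_iff (K₂ := K₂), ← meets_inlPair_iff (K₂ := K₂) (F₁ p)]
    have := hS (.inl p) (.inl q)
    rwa [hF₁, hF₁] at this
  obtain ⟨g₂, hg₂⟩ := exists_aut_of_meets_iff hfin₂ h₂ hbd₂ hcyc₂ F₂ fun p q => by
    rw [← meets_inrPair_iff (K₁ := K₁), ← meets_inrPair_iff (K₁ := K₁) (F₂ p)]
    have := hS (.inr p) (.inr q)
    rwa [hF₂, hF₂] at this
  refine ⟨(g₁, g₂), ?_⟩
  apply Subtype.ext
  ext1 v
  apply Subtype.ext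
  rw [autProdToMorse_apply]
  obtain ⟨p, hp⟩ := sumPairEquiv.surjective
    (⟨v.1, mem_vertices_morseComplex.1 v.2⟩ : HassePair (K₁.disjUnion K₂))
  have hv : v.1 = (sumPairEquiv p).1 := by rw [hp]
  have hfv : (f.1 v).1 = (sumPairEquiv (S p)).1 := by
    rw [hSapp, hp]; rfl
  rw [hv, hfv]
  rcases p with p | p
  · rw [hF₁]
    refine (mapPairs_sumPerm_inlPair (g₁, g₂) p).trans ?_
    rw [← hg₁]; rfl
  · rw [hF₂]
    refine (mapPairs_sumPerm_inrPair (g₁, g₂) p).trans ?_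
    rw [← hg₂]; rfl

end DisjUnion

end PreAbstractSimplicialComplex

theorem mainTheorem9 {α : Type*} {β : Type*}
    (K₁ : PreAbstractSimplicialComplex α) (K₂ : PreAbstractSimplicialComplex β)
    (hfin₁ : K₁.faces.Finite) (hfin₂ : K₂.faces.Finite)
    (hconn₁ : K₁.IsConnected) (hconn₂ : K₂.IsConnected)
    (hbd₁ : ∀ n : ℕ, ¬ K₁.Isomorphic (PreAbstractSimplicialComplex.simplexBoundary n))
    (hbd₂ : ∀ n : ℕ, ¬ K₂.Isomorphic (PreAbstractSimplicialComplex.simplexBoundary n))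
    (hcyc₁ : ∀ n : ℕ, 3 ≤ n → ¬ K₁.Isomorphic (PreAbstractSimplicialComplex.cycle n))
    (hcyc₂ : ∀ n : ℕ, 3 ≤ n → ¬ K₂.Isomorphic (PreAbstractSimplicialComplex.cycle n))
    (hfc : ¬ ∃ (U₁ : PreAbstractSimplicialComplex α) (U₂ : PreAbstractSimplicialComplex β),
      U₁.faces.Nonempty ∧ U₂.faces.Nonempty ∧
      U₁.IsFullyConnected K₁ ∧ U₂.IsFullyConnected K₂ ∧ U₁.Isomorphic U₂) :
    Nonempty ((K₁.disjUnion K₂).morseComplex.Aut ≃* K₁.Aut × K₂.Aut) := by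
  obtain ⟨v₁⟩ := hconn₁.nonempty
  obtain ⟨v₂⟩ := hconn₂.nonempty
  have hiso : ¬ K₁.Isomorphic K₂ := fun h => hfc ⟨K₁, K₂, ⟨_, v₁.2⟩, ⟨_, v₂.2⟩,
    K₁.isFullyConnected_self, K₂.isFullyConnected_self, h⟩
  exact ⟨(MulEquiv.ofBijective (PreAbstractSimplicialComplex.autProdToMorse K₁ K₂)
    ⟨PreAbstractSimplicialComplex.injective_autProdToMorse hconn₁ hconn₂,
      PreAbstractSimplicialComplex.surjective_autProdToMorse hfin₁ hfin₂ hconn₁ hconn₂ hbd₁ hbd₂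
        hcyc₁ hcyc₂ hiso⟩).symm⟩
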